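/- For a real number $y$ and positive integers $k,\ell$, let $\mathcal N(y;k,\ell)$ denote the number of pairs of ordered tuples $(p_1,\ldots,p_k)$ and $(q_1,\ldots,q_\ell)$, repetitions allowed, where the $p_i$ are primes in $(y/2,y]$, the $q_j$ are primes in $(y/4,y/2]$, and $$p_1\cdots p_k\equiv 1 \pmod{q_1\cdots q_\ell}.$$ Put $$\lambda=\sum_{\substack{y/4<q\le y/2\\ q\text{ prime}}}\frac1q,\qquad P=\#\{p \text{ prime}: y/2<p\le y\}.$$ There is an absolute constant $C>0$ such that for every real $y\ge 10$ and all integers $k,\ell$ with $1\le \ell\le k\le y^{1/3}/(\log y)^2$ the following hold. (i) If $\ell\le k/4$, then $\mathcal N(y;k,\ell)=\lambda^\ell P^k\bigl(1+O(1/\log y)\bigr)$; that is, $$\bigl|\mathcal N(y;k,\ell)-\lambda^\ell P^k\bigr|\le C\,\frac{\lambda^\ell P^k}{\log y}.$$ (ii) If $k/4\le \ell\le k/2$, then $\mathcal N(y;k,\ell)=\lambda^\ell P^k\bigl(1+O(1/\log y)\bigr)+O\bigl(\ell^{k-\ell}(4\lambda P)^\ell y^{k/2}\bigr)$; that is, $$\bigl|\mathcal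 N(y;k,\ell)-\lambda^\ell P^k\bigr|\le C\,\frac{\lambda^\ell P^k}{\log y}+C\,\ell^{k-\ell}(4\lambda P)^\ell y^{k/2}.$$ -/

import Mathlib

namespace SUnit

/-- The finite set of primes in the real interval `(a, b]`. -/
noncomputable def primesIoc (a b : ℝ) : Finset ℕ :=
  (Finset.range (⌊b⌋₊ + 1)).filter (fun p => p.Prime ∧ a < (p : ℝ) ∧ (p : ℝ) ≤ b)

/-- The number `𝒩(y; k, ℓ)` of pairs of ordered tuples: `p` of `k` primes from `(y/2, y]` and
`q` of `ℓ` primes from `(y/4, y/2]` (repetitions allowed) such that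
`p₁ ⋯ p_k ≡ 1 (mod q₁ ⋯ q_ℓ)`. -/
noncomputable def solCount (y : ℝ) (k l : ℕ) : ℕ :=
  (((Fintype.piFinset fun _ : Fin k => primesIoc (y / 2) y) ×ˢ
    (Fintype.piFinset fun _ : Fin l => primesIoc (y / 4) (y / 2))).filter
      (fun x => (∏ i, x.1 i) ≡ 1 [MOD ∏ j, x.2 j])).card

/-- `λ`, the sum of `1/q` over the primes `q ∈ (y/4, y/2]`. -/
noncomputable def lam (y : ℝ) : ℝ := ∑ q ∈ primesIoc (y / 4) (y / 2), 1 / (q : ℝ)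

/-- `P`, the number of primes in `(y/2, y]`. -/
noncomputable def primeCount (y : ℝ) : ℝ := ((primesIoc (y / 2) y).card : ℝ)

end SUnit

/-!
The count is expanded in Dirichlet characters modulo `n = q₁ ⋯ q_ℓ`. With
`S(χ) = ∑ χ(p)` over primes `p ∈ (y/2, y]`, the number of `p`-tuples with product `≡ 1 (mod n)` is
`φ(n)⁻¹ ∑_χ S(χ) ^ k`. The principal characters give `P ^ k / φ(n)`, and `n / φ(n)` is
`1 + O(1 / log y)` because `n` has few prime factors, all of size about `y`
(`prod_le_mul_totient`).

Every other `χ` is induced by a primitive character whose conductor `d > 1` is a subproduct of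
`q₁ ⋯ q_ℓ`, and `S(χ)` does not change when `χ` is replaced by that primitive character, as the
primes `p` exceed all `q`. Sorting by the number `r ≥ 1` of prime factors of `d`
(`wsum_sum_divisors_le`, `abs_card_sub_le`) leaves, for each `r`, the `k`-th moment of `S` over
primitive characters to moduli that are products of `r` primes from `(y/4, y/2]`. Two even moments
are accessible.

* The `4r`-th moment: `S ^ (2r)` is a character sum of length `y ^ (2r)`, at least the square of every
  modulus, so the large sieve loses only a constant
  (`largeSieve`, `wsum_primMoment_le_of_largeSieve`).
* The `2r`-th moment: here orthogonality modulo each single `d` suffices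
  (`wsum_primMoment_le_of_orthogonality`).

In both, the coefficients are bounded by a factorial through unique factorization
(`card_filter_prod_eq_le`). If `4r ≤ k`, the trivial bound `|S| ≤ P` reduces the `k`-th moment to the
`4r`-th, and the hypothesis `k ≤ y^{1/3} / (log y)^2` makes the resulting terms decay geometrically
in `r`, with sum `O(1 / log y)` relative to the main term (`largeSieve_term_le`). If
`2r ≤ k < 4r`, interpolating between the two moments gives the second error term
(`interpolated_term_le`), with bounds that decay geometrically in `ℓ - r`. In this range the constant
`4` in `(4 λ P) ^ ℓ` must be met exactly; this uses the factor `e⁻ⁿ` in Stirling's bound for the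
factorials and `P ≤ 3.5 λ y`, which follows from the estimates of Chebyshev and Bertrand for primes
in dyadic intervals (`eventually_card_primesIoc_ge`, `eventually_card_primesIoc_le`).

All this needs `y` large. For bounded `y` the hypothesis bounds `k` and `ℓ`, and the trivial bound
`𝒩 ≤ y ^ ℓ λ ^ ℓ P ^ k` is enough (`abs_solCount_sub_le_of_le`).
-/

namespace SUnit

open MeasureTheory Finset

/-! ### The additive large sieve -/

/-- Gallagher's form of the Sobolev inequality on an interval of length `δ`. -/
theorem le_average_add_integral_deriv {f f' : ℝ → ℝ} (hf : ∀ t, HasDerivAt f (f' t) t)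
    (hf' : Continuous f') {x δ : ℝ} (hδ : 0 < δ) :
    f x ≤ δ⁻¹ * (∫ t in x..x + δ, f t) + ∫ t in x..x + δ, |f' t| := by
  set K := ∫ t in x..x + δ, |f' t| with hK
  have hcf : Continuous f := continuous_iff_continuousAt.2 fun t => (hf t).continuousAt
  have hpt : ∀ t ∈ Set.Icc x (x + δ), f x ≤ f t + K := by
    intro t ht
    have h1 : ∫ s in x..t, f' s = f t - f x :=
      intervalIntegral.integral_eq_sub_of_hasDerivAt (fun s _ => hf s) (hf'.intervalIntegrable _ _)
    have h2 : |∫ s in x..t, f' s| ≤ ∫ s in x..t, |f' s| :=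
      intervalIntegral.abs_integral_le_integral_abs ht.1
    have h3 : ∫ s in x..t, |f' s| ≤ K :=
      intervalIntegral.integral_mono_interval le_rfl ht.1 ht.2
        (Filter.Eventually.of_forall fun s => abs_nonneg _) (hf'.abs.intervalIntegrable _ _)
    have h4 := neg_abs_le (∫ s in x..t, f' s)
    linarith
  have h : ∫ _t in x..x + δ, f x ≤ ∫ t in x..x + δ, (f t + K) :=
    intervalIntegral.integral_mono_on (by linarith) (continuous_const.intervalIntegrable _ _)
      ((hcf.add continuous_const).intervalIntegrable _ _) hpt
  rw [intervalIntegral.integral_add (hcf.intervalIntegrable _ _)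
    (continuous_const.intervalIntegrable _ _)] at h
  simp only [intervalIntegral.integral_const, add_sub_cancel_left, smul_eq_mul] at h
  have h5 := mul_le_mul_of_nonneg_left h (inv_nonneg.2 hδ.le)
  rwa [mul_add, inv_mul_cancel_left₀ hδ.ne', inv_mul_cancel_left₀ hδ.ne'] at h5

/-- The trigonometric polynomial `x ↦ ∑ n ∈ s, a n * exp (2 π i n x)`. -/
noncomputable def expSum (s : Finset ℕ) (a : ℕ → ℂ) (x : ℝ) : ℂ :=
  ∑ n ∈ s, a n * Complex.exp (2 * Real.pi * Complex.I * n * x)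

theorem hasDerivAt_expSum (s : Finset ℕ) (a : ℕ → ℂ) (x : ℝ) :
    HasDerivAt (expSum s a) (expSum s (fun n => 2 * Real.pi * Complex.I * n * a n) x) x := by
  unfold expSum
  refine HasDerivAt.fun_sum fun n _ => ?_
  have h : HasDerivAt (fun x : ℝ => (2 * Real.pi * Complex.I * n * x : ℂ))
      (2 * Real.pi * Complex.I * n) x := by
    simpa using (Complex.ofRealCLM.hasDerivAt (x := x)).const_mul (2 * Real.pi * Complex.I * n : ℂ)
  refine (h.cexp.const_mul (a n)).congr_deriv ?_
  ring

theorem continuous_expSum (s : Finset ℕ) (a : ℕ → ℂ) : Continuous (expSum s a) :=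
  continuous_iff_continuousAt.2 fun t => (hasDerivAt_expSum s a t).continuousAt

theorem integral_exp_int (m : ℤ) :
    ∫ t in (0 : ℝ)..2, Complex.exp (2 * Real.pi * Complex.I * m * t) = if m = 0 then 2 else 0 := by
  split_ifs with h
  · simp [h]
  · have hc : (2 * Real.pi * Complex.I * m : ℂ) ≠ 0 := by
      simp [h, Real.pi_ne_zero]
    rw [integral_exp_mul_complex hc]
    have : Complex.exp (2 * Real.pi * Complex.I * m * 2) = 1 := by
      rw [Complex.exp_eq_one_iff]
      exact ⟨2 * m, by push_cast; ring⟩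
    simp [this]

/-- Parseval's identity, over two periods. -/
theorem integral_normSq_expSum (s : Finset ℕ) (a : ℕ → ℂ) :
    ∫ t in (0 : ℝ)..2, ‖expSum s a t‖ ^ 2 = 2 * ∑ n ∈ s, ‖a n‖ ^ 2 := by
  have h : ∀ t : ℝ, ((‖expSum s a t‖ ^ 2 : ℝ) : ℂ) = ∑ n ∈ s, ∑ m ∈ s,
      a n * (starRingEnd ℂ) (a m) *
        Complex.exp (2 * Real.pi * Complex.I * ((n : ℤ) - (m : ℤ) : ℤ) * t) := by
    intro t
    rw [Complex.ofReal_pow, ← Complex.mul_conj', expSum, map_sum, Finset.sum_mul_sum]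
    refine Finset.sum_congr rfl fun n _ => Finset.sum_congr rfl fun m _ => ?_
    rw [map_mul, ← Complex.exp_conj, mul_mul_mul_comm, ← Complex.exp_add]
    congr 2
    simp only [map_mul, Complex.conj_I, Complex.conj_ofReal, map_natCast, map_ofNat]
    push_cast
    ring
  have hC : ((∫ t in (0 : ℝ)..2, ‖expSum s a t‖ ^ 2 : ℝ) : ℂ) = 2 * ∑ n ∈ s, (‖a n‖ ^ 2 : ℝ) := by
    rw [← intervalIntegral.integral_ofReal]
    simp_rw [h]
    rw [intervalIntegral.integral_finsetSum fun n _ =>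
      Continuous.intervalIntegrable (by fun_prop) _ _]
    rw [Complex.ofReal_sum, Finset.mul_sum]
    refine Finset.sum_congr rfl fun n hn => ?_
    rw [intervalIntegral.integral_finsetSum fun n _ =>
      Continuous.intervalIntegrable (by fun_prop) _ _]
    simp_rw [intervalIntegral.integral_const_mul, integral_exp_int]
    rw [Finset.sum_eq_single_of_mem n hn]
    · rw [if_pos (by simp), Complex.mul_conj']
      push_cast
      ring
    · intro m _ hm
      rw [if_neg, mul_zero]
      intro h0
      exact hm (by omega)
  exact_mod_cast hC

theorem sum_integral_le_integral {X : Finset ℝ} {δ : ℝ} (hδ : 0 < δ) (hδ1 : δ ≤ 1)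
    (hX : ∀ x ∈ X, 0 ≤ x ∧ x ≤ 1) (hsep : ∀ x ∈ X, ∀ x' ∈ X, x ≠ x' → δ ≤ |x - x'|)
    {g : ℝ → ℝ} (hg : Continuous g) (hg0 : ∀ t, 0 ≤ g t) :
    ∑ x ∈ X, ∫ t in x..x + δ, g t ≤ ∫ t in (0 : ℝ)..2, g t := by
  have h1 : ∀ x ∈ X, ∫ t in x..x + δ, g t = ∫ t in Set.Ioc x (x + δ), g t := fun x _ =>
    intervalIntegral.integral_of_le (by linarith)
  rw [Finset.sum_congr rfl h1, ← integral_biUnion_finset X (fun x _ => measurableSet_Ioc),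
    intervalIntegral.integral_of_le (by norm_num)]
  · refine setIntegral_mono_set ?_ (Filter.Eventually.of_forall hg0) ?_
    · exact (hg.intervalIntegrable 0 2).1
    · refine Filter.Eventually.of_forall ?_
      refine Set.iUnion₂_subset fun x hx t ht => ?_
      have := hX x hx
      exact ⟨by linarith [ht.1], by linarith [ht.2]⟩
  · intro x hx x' hx' hne
    rw [Function.onFun, Set.disjoint_left]
    rintro t ⟨h1, h2⟩ ⟨h3, h4⟩
    have := hsep x hx x' hx' hne
    rcases abs_cases (x - x') with ⟨h, _⟩ | ⟨h, _⟩ <;> rw [h] at this <;> linarith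
  · intro x _
    exact (hg.intervalIntegrable x (x + δ)).1

/-- The additive large sieve, by Gallagher's method. The points are separated as real numbers in
`[0, 1]`; separation modulo `1` is not needed because the integral is taken over `[0, 2]`. -/
theorem additive_largeSieve {X : Finset ℝ} {δ : ℝ} (hδ : 0 < δ) (hδ1 : δ ≤ 1)
    (hX : ∀ x ∈ X, 0 ≤ x ∧ x ≤ 1) (hsep : ∀ x ∈ X, ∀ x' ∈ X, x ≠ x' → δ ≤ |x - x'|)
    {s : Finset ℕ} {N : ℝ} (hN : 0 < N) (hs : ∀ n ∈ s, (n : ℝ) ≤ N) (a : ℕ → ℂ) :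
    ∑ x ∈ X, ‖expSum s a x‖ ^ 2 ≤ (2 * δ⁻¹ + 8 * Real.pi * N) * ∑ n ∈ s, ‖a n‖ ^ 2 := by
  set b : ℕ → ℂ := fun n => 2 * Real.pi * Complex.I * n * a n with hb
  have hS := continuous_expSum s a
  have hS' := continuous_expSum s b
  set f' : ℝ → ℝ := fun t => 2 * inner ℝ (expSum s a t) (expSum s b t) with hf'
  have hcf' : Continuous f' := by
    rw [hf']
    fun_prop
  have hder : ∀ t, HasDerivAt (fun t => ‖expSum s a t‖ ^ 2) (f' t) t := fun t =>
    (hasDerivAt_expSum s a t).norm_sq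
  have hπN : 0 < 2 * Real.pi * N := by positivity
  -- The weight `2πN` balances the two `L²` norms, since differentiation costs at most `2πN`.
  have hbound : ∀ t, |f' t| ≤
      2 * Real.pi * N * ‖expSum s a t‖ ^ 2 + (2 * Real.pi * N)⁻¹ * ‖expSum s b t‖ ^ 2 := by
    intro t
    have h1 : |f' t| ≤ 2 * (‖expSum s a t‖ * ‖expSum s b t‖) := by
      rw [hf', abs_mul, abs_two]
      exact mul_le_mul_of_nonneg_left (abs_real_inner_le_norm _ _) (by norm_num)
    refine h1.trans ?_
    set u := ‖expSum s a t‖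
    set v := ‖expSum s b t‖
    have h2 : 0 ≤ (2 * Real.pi * N)⁻¹ * (2 * Real.pi * N * u - v) ^ 2 := by positivity
    have h3 : (2 * Real.pi * N)⁻¹ * (2 * Real.pi * N * u - v) ^ 2 =
      2 * Real.pi * N * u ^ 2 + (2 * Real.pi * N)⁻¹ * v ^ 2 - 2 * (u * v) := by
      field_simp
      ring
    linarith
  have hsumb : ∑ n ∈ s, ‖b n‖ ^ 2 ≤ (2 * Real.pi * N) ^ 2 * ∑ n ∈ s, ‖a n‖ ^ 2 := by
    rw [Finset.mul_sum]
    refine Finset.sum_le_sum fun n hn => ?_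
    have : ‖b n‖ = 2 * Real.pi * n * ‖a n‖ := by
      simp [hb, abs_of_pos Real.pi_pos]
    rw [this, mul_pow]
    have := hs n hn
    gcongr
  have hint : ∫ t in (0 : ℝ)..2, |f' t| ≤ 8 * Real.pi * N * ∑ n ∈ s, ‖a n‖ ^ 2 := by
    have h1 : ∫ t in (0 : ℝ)..2, |f' t| ≤ ∫ t in (0 : ℝ)..2,
        (2 * Real.pi * N * ‖expSum s a t‖ ^ 2 + (2 * Real.pi * N)⁻¹ * ‖expSum s b t‖ ^ 2) :=
      intervalIntegral.integral_mono (by norm_num) (hcf'.abs.intervalIntegrable _ _)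
        (Continuous.intervalIntegrable (by fun_prop) _ _) hbound
    rw [intervalIntegral.integral_add (Continuous.intervalIntegrable (by fun_prop) _ _)
      (Continuous.intervalIntegrable (by fun_prop) _ _), intervalIntegral.integral_const_mul,
      intervalIntegral.integral_const_mul, integral_normSq_expSum, integral_normSq_expSum] at h1
    have h2 : (2 * Real.pi * N)⁻¹ * (2 * ∑ n ∈ s, ‖b n‖ ^ 2) ≤
        (2 * Real.pi * N)⁻¹ * (2 * ((2 * Real.pi * N) ^ 2 * ∑ n ∈ s, ‖a n‖ ^ 2)) := by
      gcongr
    have h3 : (2 * Real.pi * N)⁻¹ * (2 * ((2 * Real.pi * N) ^ 2 * ∑ n ∈ s, ‖a n‖ ^ 2)) =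
      2 * (2 * Real.pi * N) * ∑ n ∈ s, ‖a n‖ ^ 2 := by
      field_simp
    rw [h3] at h2
    linarith
  calc ∑ x ∈ X, ‖expSum s a x‖ ^ 2
      ≤ ∑ x ∈ X, (δ⁻¹ * (∫ t in x..x + δ, ‖expSum s a t‖ ^ 2) + ∫ t in x..x + δ, |f' t|) :=
        Finset.sum_le_sum fun x _ => le_average_add_integral_deriv hder hcf' hδ
    _ = δ⁻¹ * (∑ x ∈ X, ∫ t in x..x + δ, ‖expSum s a t‖ ^ 2) +
          ∑ x ∈ X, ∫ t in x..x + δ, |f' t| := by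
        rw [Finset.sum_add_distrib, Finset.mul_sum]
    _ ≤ δ⁻¹ * (∫ t in (0 : ℝ)..2, ‖expSum s a t‖ ^ 2) + ∫ t in (0 : ℝ)..2, |f' t| := by
        have h1 := sum_integral_le_integral hδ hδ1 hX hsep
          (g := fun t => ‖expSum s a t‖ ^ 2) (by fun_prop) fun t => by positivity
        have h2 := sum_integral_le_integral hδ hδ1 hX hsep hcf'.abs fun t => abs_nonneg _
        gcongr
    _ ≤ δ⁻¹ * (2 * ∑ n ∈ s, ‖a n‖ ^ 2) + 8 * Real.pi * N * ∑ n ∈ s, ‖a n‖ ^ 2 := by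
        rw [integral_normSq_expSum]
        gcongr
    _ = _ := by ring

/-! ### The multiplicative large sieve -/

open Classical in
/-- The primitive Dirichlet characters modulo `d`. -/
noncomputable def primitiveChars (d : ℕ) : Finset (DirichletCharacter ℂ d) :=
  Finset.univ.filter fun χ => χ.IsPrimitive

/-- Orthogonality of the characters modulo `d` on units. -/
theorem sum_char_mul_conj_char {d : ℕ} [NeZero d] (u v : (ZMod d)ˣ) :
    ∑ χ : DirichletCharacter ℂ d, χ u * (starRingEnd ℂ) (χ v) =
      if u = v then (d.totient : ℂ) else 0 := by
  have h := DirichletCharacter.sum_char_inv_mul_char_eq ℂ v.isUnit (u : ZMod d)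
  simp only [Units.val_inj, eq_comm (a := v)] at h
  rw [← h]
  refine Finset.sum_congr rfl fun χ _ => ?_
  rw [mul_comm]
  congr 1
  rw [← RCLike.star_def, MulChar.star_apply', MulChar.inv_apply, Ring.inverse_unit,
    ZMod.inv_coe_unit]

theorem sum_norm_sq_sum_char {d : ℕ} [NeZero d] {ι : Type*} (s : Finset ι) (f : ι → (ZMod d)ˣ)
    (g : ι → ℂ) :
    ((∑ χ : DirichletCharacter ℂ d, ‖∑ i ∈ s, χ (f i) * g i‖ ^ 2 : ℝ) : ℂ) =
      d.totient * ∑ i ∈ s, ∑ j ∈ s, if f i = f j then g i * (starRingEnd ℂ) (g j) else 0 := by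
  have h : ∀ χ : DirichletCharacter ℂ d, ((‖∑ i ∈ s, χ (f i) * g i‖ ^ 2 : ℝ) : ℂ) =
      ∑ i ∈ s, ∑ j ∈ s, χ (f i) * (starRingEnd ℂ) (χ (f j)) * (g i * (starRingEnd ℂ) (g j)) := by
    intro χ
    rw [Complex.ofReal_pow, ← Complex.mul_conj', map_sum, Finset.sum_mul_sum]
    refine Finset.sum_congr rfl fun n _ => Finset.sum_congr rfl fun m _ => ?_
    rw [map_mul, mul_mul_mul_comm]
  rw [Complex.ofReal_sum, Finset.sum_congr rfl fun χ _ => h χ, Finset.sum_comm, Finset.mul_sum]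
  refine Finset.sum_congr rfl fun i _ => ?_
  rw [Finset.sum_comm, Finset.mul_sum]
  refine Finset.sum_congr rfl fun j _ => ?_
  rw [← Finset.sum_mul, sum_char_mul_conj_char]
  split_ifs <;> simp

theorem sum_norm_sq_sum_units {d : ℕ} [NeZero d] (g : ZMod d → ℂ) :
    ∑ χ : DirichletCharacter ℂ d, ‖∑ b, χ b * g b‖ ^ 2 =
      d.totient * ∑ u : (ZMod d)ˣ, ‖g u‖ ^ 2 := by
  have h := sum_norm_sq_sum_char (d := d) Finset.univ id (fun u => g u)
  simp only [id, Finset.sum_ite_eq, Finset.mem_univ, if_true, Complex.mul_conj'] at h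
  have h2 : ∀ χ : DirichletCharacter ℂ d, ∑ b, χ b * g b = ∑ u : (ZMod d)ˣ, χ u * g u := by
    intro χ
    symm
    refine Finset.sum_of_injOn (fun u : (ZMod d)ˣ => (u : ZMod d)) (fun u _ v _ h => Units.ext h)
      (fun _ _ => Finset.mem_coe.2 (Finset.mem_univ _)) ?_ (fun _ _ => rfl)
    intro b _ hb
    rw [MulChar.map_nonunit χ, zero_mul]
    rintro ⟨u, rfl⟩
    exact hb ⟨u, by simp, rfl⟩
  simp_rw [h2]
  exact_mod_cast h

/-- The Gauss sum of a primitive character has absolute value `√d`. Applying the discrete Fourier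
transform twice to `χ` gives the product of the Gauss sums of `χ` and `χ⁻¹`, which have the same
absolute value. -/
theorem norm_sq_gaussSum {d : ℕ} [NeZero d] {χ : DirichletCharacter ℂ d} (hχ : χ.IsPrimitive) :
    ‖gaussSum χ ZMod.stdAddChar‖ ^ 2 = d := by
  have hinv : χ⁻¹.IsPrimitive := by
    rw [DirichletCharacter.isPrimitive_def, DirichletCharacter.conductor_inv]
    exact hχ
  have h1 : ZMod.dft (ZMod.dft χ) (-1) = (d : ℂ) * χ 1 := by
    rw [ZMod.dft_dft]
    simp
  have h2 : (ZMod.dft χ : ZMod d → ℂ) = fun k => gaussSum χ ZMod.stdAddChar * χ⁻¹ (-k) := by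
    ext k
    rw [hχ.fourierTransform_eq_inv_mul_gaussSum, mul_comm]
  rw [h2, ZMod.dft_const_mul, ZMod.dft_comp_neg] at h1
  dsimp only at h1
  rw [hinv.fourierTransform_eq_inv_mul_gaussSum] at h1
  have h6 : ‖χ (-1)‖ = 1 := by simpa using χ.unit_norm_eq_one (-1)
  have h3 : ‖gaussSum χ⁻¹ (ZMod.stdAddChar (N := d))‖ = ‖gaussSum χ (ZMod.stdAddChar (N := d))‖ := by
    have h4 : (starRingEnd ℂ) (gaussSum χ (ZMod.stdAddChar (N := d))) =
        gaussSum χ⁻¹ ((ZMod.stdAddChar (N := d)).mulShift (-1)) := by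
      rw [gaussSum, gaussSum, map_sum]
      refine Finset.sum_congr rfl fun a _ => ?_
      rw [map_mul, ← RCLike.star_def, MulChar.star_apply', AddChar.mulShift_apply, neg_one_mul,
        RCLike.star_def, AddChar.map_neg_eq_conj]
    rw [gaussSum_mulShift_of_isPrimitive _ hinv, inv_inv] at h4
    have h5 := congrArg norm h4
    rw [RCLike.norm_conj, norm_mul] at h5
    rw [h6, one_mul] at h5
    exact h5.symm
  have h4 := congrArg norm h1
  simp only [inv_inv, neg_neg, map_one, one_mul, norm_mul, h3, h6, mul_one,
    Complex.norm_natCast] at h4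
  rw [sq]
  exact h4

/-- The passage from multiplicative to additive characters: multiplying by the Gauss sum of `χ⁻¹`
turns a character sum into a combination of trigonometric sums at fractions with denominator `d`. -/
theorem sum_char_mul_gaussSum {d : ℕ} [NeZero d] {χ : DirichletCharacter ℂ d}
    (hχ : χ.IsPrimitive) (s : Finset ℕ) (a : ℕ → ℂ) :
    (∑ n ∈ s, a n * χ n) * gaussSum χ⁻¹ ZMod.stdAddChar =
      ∑ b : ZMod d, χ⁻¹ b * expSum s a ((b.val : ℝ) / d) := by
  have hinv : χ⁻¹.IsPrimitive := by
    rw [DirichletCharacter.isPrimitive_def, DirichletCharacter.conductor_inv]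
    exact hχ
  have h : ∀ n : ℕ, χ n * gaussSum χ⁻¹ ZMod.stdAddChar =
      ∑ b : ZMod d, χ⁻¹ b * Complex.exp (2 * Real.pi * Complex.I * n * ((b.val : ℝ) / d : ℝ)) := by
    intro n
    have := gaussSum_mulShift_of_isPrimitive (ZMod.stdAddChar (N := d)) hinv (n : ZMod d)
    rw [inv_inv] at this
    rw [← this, gaussSum]
    refine Finset.sum_congr rfl fun b _ => ?_
    congr 1
    rw [AddChar.mulShift_apply]
    have hb : (n : ZMod d) * b = ((n * b.val : ℤ) : ZMod d) := by simp
    rw [hb, ZMod.stdAddChar_coe]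
    congr 1
    push_cast
    ring
  rw [Finset.sum_mul]
  simp_rw [mul_assoc, h, expSum, Finset.mul_sum]
  rw [Finset.sum_comm]
  refine Finset.sum_congr rfl fun b _ => Finset.sum_congr rfl fun n _ => ?_
  ring

/-- The reduced fractions with denominator `d`. -/
noncomputable def reducedFractions (d : ℕ) : Finset ℝ :=
  ((Finset.range d).filter fun b => b.Coprime d).image fun b : ℕ => (b : ℝ) / d

theorem sum_primitiveChars_le {d : ℕ} (hd : 0 < d) (s : Finset ℕ) (a : ℕ → ℂ) :
    ∑ χ ∈ primitiveChars d, ‖∑ n ∈ s, a n * χ n‖ ^ 2 ≤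
      ∑ x ∈ reducedFractions d, ‖expSum s a x‖ ^ 2 := by
  have : NeZero d := ⟨hd.ne'⟩
  have hd0 : (0 : ℝ) < d := by exact_mod_cast hd
  classical
  set g : ZMod d → ℂ := fun b => expSum s a ((b.val : ℝ) / d) with hg
  have h1 : ∀ χ ∈ primitiveChars d,
      d * ‖∑ n ∈ s, a n * χ n‖ ^ 2 = ‖∑ b, χ⁻¹ b * g b‖ ^ 2 := by
    intro χ hχ
    have hp : χ.IsPrimitive := (Finset.mem_filter.1 hχ).2
    have hinv : χ⁻¹.IsPrimitive := by
      rw [DirichletCharacter.isPrimitive_def, DirichletCharacter.conductor_inv]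
      exact hp
    rw [← sum_char_mul_gaussSum hp, norm_mul, mul_pow, norm_sq_gaussSum hinv, mul_comm]
  have h2 : d * ∑ χ ∈ primitiveChars d, ‖∑ n ∈ s, a n * χ n‖ ^ 2 ≤
      ∑ χ : DirichletCharacter ℂ d, ‖∑ b, χ b * g b‖ ^ 2 := by
    rw [Finset.mul_sum, Finset.sum_congr rfl h1]
    refine (Finset.sum_le_sum_of_subset_of_nonneg (Finset.subset_univ _)
      fun _ _ _ => by positivity).trans_eq ?_
    exact Fintype.sum_equiv (Equiv.inv (DirichletCharacter ℂ d)) _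
      (fun χ : DirichletCharacter ℂ d => ‖∑ b, χ b * g b‖ ^ 2) fun χ => rfl
  rw [sum_norm_sq_sum_units] at h2
  have h3 : ∑ u : (ZMod d)ˣ, ‖g u‖ ^ 2 ≤ ∑ x ∈ reducedFractions d, ‖expSum s a x‖ ^ 2 := by
    have hinj : Function.Injective fun u : (ZMod d)ˣ => ((u : ZMod d).val : ℝ) / d := by
      intro u v huv
      have : ((u : ZMod d).val : ℝ) = (v : ZMod d).val := by
        simpa [div_left_inj' hd0.ne'] using huv
      exact Units.ext (ZMod.val_injective d (by exact_mod_cast this))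
    rw [← Finset.sum_image (f := fun x => ‖expSum s a x‖ ^ 2)
      (g := fun u : (ZMod d)ˣ => ((u : ZMod d).val : ℝ) / d) (hinj.injOn)]
    refine Finset.sum_le_sum_of_subset_of_nonneg ?_ fun _ _ _ => by positivity
    intro x hx
    obtain ⟨u, -, rfl⟩ := Finset.mem_image.1 hx
    exact Finset.mem_image.2 ⟨(u : ZMod d).val, Finset.mem_filter.2
      ⟨Finset.mem_range.2 (ZMod.val_lt _), ZMod.val_coe_unit_coprime u⟩, rfl⟩
  have h4 : (d.totient : ℝ) ≤ d := by exact_mod_cast Nat.totient_le d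
  have h5 : (d.totient : ℝ) * ∑ u : (ZMod d)ˣ, ‖g u‖ ^ 2 ≤
      d * ∑ x ∈ reducedFractions d, ‖expSum s a x‖ ^ 2 := by
    gcongr
  exact le_of_mul_le_mul_left (h2.trans h5) hd0

theorem reducedFractions_unique {d d' b b' : ℕ} (hd : 0 < d) (hd' : 0 < d') (hb : b.Coprime d)
    (hb' : b'.Coprime d') (h : (b : ℝ) / d = b' / d') : d = d' := by
  have hd0 : (d : ℝ) ≠ 0 := by exact_mod_cast hd.ne'
  have hd0' : (d' : ℝ) ≠ 0 := by exact_mod_cast hd'.ne'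
  rw [div_eq_div_iff hd0 hd0'] at h
  have h' : b * d' = b' * d := by exact_mod_cast h
  refine Nat.dvd_antisymm ?_ ?_
  · exact hb.symm.dvd_of_dvd_mul_left ⟨b', by rw [h']; ring⟩
  · exact hb'.symm.dvd_of_dvd_mul_left ⟨b, by rw [← h']; ring⟩

/-- The multiplicative large sieve inequality over primitive characters to moduli in `D`. -/
theorem largeSieve {D : Finset ℕ} {M : ℝ} (hM : 1 ≤ M) (hD : ∀ d ∈ D, 0 < d ∧ (d : ℝ) ≤ M)
    {s : Finset ℕ} {N : ℝ} (hN : 0 < N) (hs : ∀ n ∈ s, (n : ℝ) ≤ N) (a : ℕ → ℂ) :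
    ∑ d ∈ D, ∑ χ ∈ primitiveChars d, ‖∑ n ∈ s, a n * χ n‖ ^ 2 ≤
      (2 * M ^ 2 + 8 * Real.pi * N) * ∑ n ∈ s, ‖a n‖ ^ 2 := by
  have hM0 : 0 < M := by linarith
  have hX : ∑ d ∈ D, ∑ χ ∈ primitiveChars d, ‖∑ n ∈ s, a n * χ n‖ ^ 2 ≤
      ∑ x ∈ D.biUnion reducedFractions, ‖expSum s a x‖ ^ 2 := by
    rw [Finset.sum_biUnion]
    · exact Finset.sum_le_sum fun d hd => sum_primitiveChars_le (hD d hd).1 s a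
    · intro d hd d' hd' hne
      rw [Function.onFun, Finset.disjoint_left]
      intro x hx hx'
      obtain ⟨b, hb, rfl⟩ := Finset.mem_image.1 hx
      obtain ⟨b', hb', h⟩ := Finset.mem_image.1 hx'
      exact hne (reducedFractions_unique (hD d hd).1 (hD d' hd').1 (Finset.mem_filter.1 hb).2
        (Finset.mem_filter.1 hb').2 h.symm)
  refine hX.trans ?_
  have hδ : 0 < (M ^ 2)⁻¹ := by positivity
  have := additive_largeSieve (X := D.biUnion reducedFractions) hδ
    (inv_le_one_of_one_le₀ (one_le_pow₀ hM)) ?_ ?_ hN hs a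
  · rwa [inv_inv] at this
  · intro x hx
    obtain ⟨d, hd, hx⟩ := Finset.mem_biUnion.1 hx
    obtain ⟨b, hb, rfl⟩ := Finset.mem_image.1 hx
    have hbd := Finset.mem_range.1 (Finset.mem_filter.1 hb).1
    have hd0 : (0 : ℝ) < d := by exact_mod_cast (hD d hd).1
    refine ⟨by positivity, ?_⟩
    rw [div_le_one hd0]
    exact_mod_cast hbd.le
  · intro x hx x' hx' hne
    obtain ⟨d, hd, hx⟩ := Finset.mem_biUnion.1 hx
    obtain ⟨b, hb, rfl⟩ := Finset.mem_image.1 hx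
    obtain ⟨d', hd', hx'⟩ := Finset.mem_biUnion.1 hx'
    obtain ⟨b', hb', rfl⟩ := Finset.mem_image.1 hx'
    have hd0 : (0 : ℝ) < d := by exact_mod_cast (hD d hd).1
    have hd0' : (0 : ℝ) < d' := by exact_mod_cast (hD d' hd').1
    -- Distinct fractions differ by a nonzero integer over `d * d'`.
    have h1 : (b : ℝ) / d - b' / d' = (((b : ℤ) * d' - b' * d : ℤ) : ℝ) / (d * d') := by
      push_cast
      field_simp
    have h2 : ((b : ℤ) * d' - b' * d : ℤ) ≠ 0 := by
      intro h
      rw [h, Int.cast_zero, zero_div, sub_eq_zero] at h1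
      exact hne h1
    have h3 : (1 : ℝ) ≤ |(((b : ℤ) * d' - b' * d : ℤ) : ℝ)| := by
      exact_mod_cast Int.one_le_abs h2
    rw [h1, abs_div, abs_of_pos (mul_pos hd0 hd0')]
    have h4 : (d : ℝ) * d' ≤ M ^ 2 := by
      rw [sq]
      exact mul_le_mul (hD d hd).2 (hD d' hd').2 hd0'.le hM0.le
    rw [inv_eq_one_div]
    gcongr

/-! ### Moments of character sums over primes -/

/-- The `m`-tuples with entries in `A`. -/
def tuples (A : Finset ℕ) (m : ℕ) : Finset (Fin m → ℕ) :=
  Fintype.piFinset fun _ : Fin m => A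

theorem mem_tuples {A : Finset ℕ} {m : ℕ} {x : Fin m → ℕ} : x ∈ tuples A m ↔ ∀ i, x i ∈ A := by
  simp [tuples]

theorem card_tuples (A : Finset ℕ) (m : ℕ) : (tuples A m).card = A.card ^ m := by
  simp [tuples]

theorem prod_pos_of_mem_tuples {A : Finset ℕ} {m : ℕ} (hA : ∀ p ∈ A, p.Prime) {x : Fin m → ℕ}
    (hx : x ∈ tuples A m) : 0 < ∏ i, x i :=
  Finset.prod_pos fun i _ => (hA _ (mem_tuples.1 hx i)).pos

/-- By unique factorization, a product of `m` primes determines them up to order. -/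
theorem card_filter_prod_eq_le {A : Finset ℕ} (hA : ∀ p ∈ A, p.Prime) (m n : ℕ) :
    ((tuples A m).filter fun x => ∏ i, x i = n).card ≤ m.factorial := by
  by_cases hne : ((tuples A m).filter fun x => ∏ i, x i = n) = ∅
  · rw [hne]
    simp
  have hperm : ∀ x ∈ (tuples A m).filter fun x => ∏ i, x i = n,
      (List.ofFn x).Perm n.primeFactorsList := by
    intro x hx
    obtain ⟨hx, hn⟩ := Finset.mem_filter.1 hx
    refine Nat.primeFactorsList_unique (by rw [List.prod_ofFn, hn]) fun p hp => ?_
    obtain ⟨i, rfl⟩ := (List.mem_ofFn' _ _).1 hp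
    exact hA _ (mem_tuples.1 hx i)
  obtain ⟨x₀, hx₀⟩ := Finset.nonempty_iff_ne_empty.2 hne
  have hlen : n.primeFactorsList.length = m := by
    rw [← (hperm x₀ hx₀).length_eq, List.length_ofFn]
  calc ((tuples A m).filter fun x => ∏ i, x i = n).card
      ≤ n.primeFactorsList.permutations.toFinset.card := by
        refine Finset.card_le_card_of_injOn (fun x => List.ofFn x) ?_
          (fun x _ y _ h => List.ofFn_injective h)
        intro x hx
        simpa using hperm x hx
    _ ≤ n.primeFactorsList.permutations.length := List.toFinset_card_le _
    _ = m.factorial := by rw [List.length_permutations, hlen]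

/-- The character sum over a finite set of integers. -/
noncomputable def charSum (A : Finset ℕ) {d : ℕ} (χ : DirichletCharacter ℂ d) : ℂ :=
  ∑ p ∈ A, χ p

theorem norm_charSum_le (A : Finset ℕ) {d : ℕ} (χ : DirichletCharacter ℂ d) :
    ‖charSum A χ‖ ≤ A.card := by
  refine (norm_sum_le_of_le A fun p _ => χ.norm_le_one p).trans ?_
  simp

theorem charSum_pow (A : Finset ℕ) {d : ℕ} (χ : DirichletCharacter ℂ d) (m : ℕ) :
    charSum A χ ^ m = ∑ x ∈ tuples A m, χ ((∏ i, x i : ℕ) : ZMod d) := by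
  rw [charSum, Finset.sum_pow']
  refine Finset.sum_congr rfl fun x _ => ?_
  rw [Nat.cast_prod, map_prod]

/-- The `k`-th absolute moment of the character sums over primitive characters modulo `d`. -/
noncomputable def primMoment (A : Finset ℕ) (k d : ℕ) : ℝ :=
  ∑ χ ∈ primitiveChars d, ‖charSum A χ‖ ^ k

theorem primMoment_nonneg (A : Finset ℕ) (k d : ℕ) : 0 ≤ primMoment A k d :=
  Finset.sum_nonneg fun _ _ => by positivity

/-- The even moments over primitive characters to moduli in `D`, by the large sieve applied to the
`m`-th power of the character sum. -/
theorem sum_primMoment_le {A : Finset ℕ} (hA : ∀ p ∈ A, p.Prime) {Y : ℝ}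
    (hAY : ∀ p ∈ A, (p : ℝ) ≤ Y) (hY : 0 < Y) {D : Finset ℕ} {M : ℝ} (hM : 1 ≤ M)
    (hD : ∀ d ∈ D, 0 < d ∧ (d : ℝ) ≤ M) (m : ℕ) :
    ∑ d ∈ D, primMoment A (2 * m) d ≤
      (2 * M ^ 2 + 8 * Real.pi * Y ^ m) * (m.factorial * (A.card : ℝ) ^ m) := by
  set s := (tuples A m).image fun x => ∏ i, x i with hs
  set a : ℕ → ℕ := fun n => ((tuples A m).filter fun x => ∏ i, x i = n).card with ha
  have hsum : ∑ n ∈ s, a n = A.card ^ m := by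
    rw [← card_tuples]
    exact (Finset.card_eq_sum_card_image _ _).symm
  have hpow : ∀ (d : ℕ) (χ : DirichletCharacter ℂ d),
      charSum A χ ^ m = ∑ n ∈ s, (a n : ℂ) * χ n := by
    intro d χ
    rw [charSum_pow, ← Finset.sum_fiberwise_of_maps_to (s := tuples A m) (t := s)
      (g := fun x => ∏ i, x i) (fun x hx => Finset.mem_image_of_mem _ hx)]
    refine Finset.sum_congr rfl fun n _ => ?_
    rw [Finset.sum_congr rfl (g := fun _ => χ n) fun x hx => by rw [(Finset.mem_filter.1 hx).2]]
    simp [ha]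
  have hsY : ∀ n ∈ s, (n : ℝ) ≤ Y ^ m := by
    intro n hn
    obtain ⟨x, hx, rfl⟩ := Finset.mem_image.1 hn
    push_cast
    calc ∏ i, (x i : ℝ) ≤ ∏ _i : Fin m, Y :=
          Finset.prod_le_prod (fun i _ => by positivity) fun i _ => hAY _ (mem_tuples.1 hx i)
      _ = Y ^ m := by simp
  have hls := largeSieve hM hD (N := Y ^ m) (by positivity) hsY fun n => (a n : ℂ)
  have hl2 : ∑ n ∈ s, ‖(a n : ℂ)‖ ^ 2 ≤ m.factorial * (A.card : ℝ) ^ m := by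
    have h1 : ∑ n ∈ s, a n ^ 2 ≤ m.factorial * A.card ^ m := by
      rw [← hsum, Finset.mul_sum]
      refine Finset.sum_le_sum fun n _ => ?_
      rw [sq]
      exact Nat.mul_le_mul_right _ (card_filter_prod_eq_le hA m n)
    simp only [Complex.norm_natCast]
    exact_mod_cast h1
  calc ∑ d ∈ D, primMoment A (2 * m) d
      = ∑ d ∈ D, ∑ χ ∈ primitiveChars d, ‖∑ n ∈ s, (a n : ℂ) * χ n‖ ^ 2 := by
        refine Finset.sum_congr rfl fun d _ => Finset.sum_congr rfl fun χ _ => ?_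
        rw [← hpow, norm_pow, ← pow_mul, mul_comm]
    _ ≤ _ := hls
    _ ≤ _ := by gcongr

theorem card_filter_modEq_le (d c N : ℕ) :
    ((Finset.range (N + 1)).filter fun n => n ≡ c [MOD d]).card ≤ N / d + 1 := by
  rw [← Finset.card_range (N / d + 1)]
  refine Finset.card_le_card_of_injOn (fun n => n / d) ?_ ?_
  · intro n hn
    have := Finset.mem_range.1 (Finset.mem_filter.1 (Finset.mem_coe.1 hn)).1
    exact Finset.mem_coe.2 (Finset.mem_range.2
      (Nat.lt_succ_of_le (Nat.div_le_div_right (Nat.le_of_lt_succ this))))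
  · intro n hn n' hn' h
    have h1 : n % d = n' % d := ((Finset.mem_filter.1 (Finset.mem_coe.1 hn)).2).trans
      ((Finset.mem_filter.1 (Finset.mem_coe.1 hn')).2).symm
    dsimp only at h
    rw [← Nat.div_add_mod n d, ← Nat.div_add_mod n' d, h, h1]

theorem card_filter_prod_modEq_le {A : Finset ℕ} (hA : ∀ p ∈ A, p.Prime) {Y : ℝ}
    (hAY : ∀ p ∈ A, (p : ℝ) ≤ Y) (hY : 0 < Y) (m d c : ℕ) :
    (((tuples A m).filter fun x => ∏ i, x i ≡ c [MOD d]).card : ℝ) ≤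
      m.factorial * (Y ^ m / d + 1) := by
  set S := (tuples A m).filter fun x => ∏ i, x i ≡ c [MOD d] with hS
  set T := (Finset.range (⌊Y ^ m⌋₊ + 1)).filter fun n => n ≡ c [MOD d]
  have h1 : S.card ≤ m.factorial * T.card := by
    refine Finset.card_le_mul_card_image_of_maps_to (f := fun x => ∏ i, x i) ?_ _ ?_
    · intro x hx
      obtain ⟨hx, hc⟩ := Finset.mem_filter.1 hx
      refine Finset.mem_filter.2 ⟨Finset.mem_range.2 (Nat.lt_succ_of_le (Nat.le_floor ?_)), hc⟩
      push_cast
      calc ∏ i, (x i : ℝ) ≤ ∏ _i : Fin m, Y :=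
            Finset.prod_le_prod (fun i _ => by positivity) fun i _ => hAY _ (mem_tuples.1 hx i)
        _ = Y ^ m := by simp
    · intro n _
      refine (Finset.card_le_card ?_).trans (card_filter_prod_eq_le hA m n)
      exact Finset.filter_subset_filter _ (Finset.filter_subset _ _)
  have h2 : (T.card : ℝ) ≤ Y ^ m / d + 1 := by
    have h3 : (T.card : ℝ) ≤ ((⌊Y ^ m⌋₊ / d : ℕ) : ℝ) + 1 := by
      exact_mod_cast card_filter_modEq_le d c ⌊Y ^ m⌋₊
    have h4 : ((⌊Y ^ m⌋₊ / d : ℕ) : ℝ) ≤ Y ^ m / d :=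
      Nat.cast_div_le.trans (by gcongr; exact Nat.floor_le (by positivity))
    linarith
  calc (S.card : ℝ) ≤ m.factorial * T.card := by exact_mod_cast h1
    _ ≤ _ := by gcongr

/-- The even moments for a single modulus `d`, counting pairs of tuples with congruent products. -/
theorem primMoment_le {A : Finset ℕ} (hA : ∀ p ∈ A, p.Prime) {Y : ℝ}
    (hAY : ∀ p ∈ A, (p : ℝ) ≤ Y) (hY : 0 < Y) {d : ℕ} (hd : 0 < d)
    (hAd : ∀ p ∈ A, p.Coprime d) (m : ℕ) :
    primMoment A (2 * m) d ≤ (A.card : ℝ) ^ m * m.factorial * (Y ^ m + d) := by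
  have : NeZero d := ⟨hd.ne'⟩
  have hd0 : (0 : ℝ) < d := by exact_mod_cast hd
  have hcop : ∀ x ∈ tuples A m, (∏ i, x i).Coprime d := fun x hx =>
    Nat.Coprime.prod_left fun i _ => hAd _ (mem_tuples.1 hx i)
  classical
  obtain ⟨f, hfx⟩ : ∃ f : (Fin m → ℕ) → (ZMod d)ˣ,
      ∀ x ∈ tuples A m, (f x : ZMod d) = ((∏ i, x i : ℕ) : ZMod d) := by
    refine ⟨fun x => if h : (∏ i, x i).Coprime d then ZMod.unitOfCoprime _ h else 1, ?_⟩
    intro x hx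
    simp only [dif_pos (hcop x hx), ZMod.coe_unitOfCoprime]
  have h := sum_norm_sq_sum_char (d := d) (tuples A m) f fun _ => 1
  have h1 : ∀ χ : DirichletCharacter ℂ d, ‖∑ x ∈ tuples A m, χ (f x) * 1‖ ^ 2 =
      ‖charSum A χ‖ ^ (2 * m) := by
    intro χ
    rw [mul_comm 2 m, pow_mul, ← norm_pow (charSum A χ), charSum_pow]
    congr 2
    refine Finset.sum_congr rfl fun x hx => ?_
    rw [mul_one, hfx x hx]
  rw [Finset.sum_congr rfl fun χ _ => h1 χ] at h
  simp only [map_one, mul_one, Finset.sum_boole] at h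
  have h2 : ∑ χ : DirichletCharacter ℂ d, ‖charSum A χ‖ ^ (2 * m) =
      d.totient * ∑ x ∈ tuples A m, (((tuples A m).filter fun z => f x = f z).card : ℝ) := by
    exact_mod_cast h
  have h3 : ∀ x ∈ tuples A m, (((tuples A m).filter fun z => f x = f z).card : ℝ) ≤
      m.factorial * (Y ^ m / d + 1) := by
    intro x hx
    refine le_trans ?_ (card_filter_prod_modEq_le hA hAY hY m d (∏ i, x i))
    refine Nat.cast_le.2 (Finset.card_le_card ?_)
    intro z hz
    obtain ⟨hz, hxz⟩ := Finset.mem_filter.1 hz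
    refine Finset.mem_filter.2 ⟨hz, ?_⟩
    rw [← ZMod.natCast_eq_natCast_iff, ← hfx z hz, ← hfx x hx, hxz]
  have h4 : (d.totient : ℝ) ≤ d := by exact_mod_cast Nat.totient_le d
  calc primMoment A (2 * m) d ≤ ∑ χ : DirichletCharacter ℂ d, ‖charSum A χ‖ ^ (2 * m) :=
        Finset.sum_le_sum_of_subset_of_nonneg (Finset.subset_univ _) fun _ _ _ => by positivity
    _ = d.totient * ∑ x ∈ tuples A m, (((tuples A m).filter fun z => f x = f z).card : ℝ) := h2
    _ ≤ d * ∑ _x ∈ tuples A m, (m.factorial * (Y ^ m / d + 1) : ℝ) := by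
        exact mul_le_mul h4 (Finset.sum_le_sum h3)
          (Finset.sum_nonneg fun _ _ => Nat.cast_nonneg _) hd0.le
    _ = _ := by
        have h5 : d * (Y ^ m / d + 1) = Y ^ m + d := by
          rw [mul_add, mul_div_cancel₀ _ hd0.ne', mul_one]
        rw [Finset.sum_const, card_tuples, nsmul_eq_mul, ← h5]
        push_cast
        ring

/-- The nonprincipal characters modulo `n`, sorted by conductor. Passing to the primitive character
does not change the sum over `A`, as `A` is coprime to `n`. -/
theorem sum_char_ne_one_le {A : Finset ℕ} {n : ℕ} [DecidableEq (DirichletCharacter ℂ n)]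
    (hn : 0 < n) (hAn : ∀ p ∈ A, p.Coprime n)
    (k : ℕ) :
    ∑ χ ∈ (Finset.univ : Finset (DirichletCharacter ℂ n)).erase 1, ‖charSum A χ‖ ^ k ≤
      ∑ d ∈ n.divisors.erase 1, primMoment A k d := by
  have : NeZero n := ⟨hn.ne'⟩
  classical
  rw [← Finset.sum_fiberwise_of_maps_to (t := n.divisors.erase 1)
    (g := fun χ : DirichletCharacter ℂ n => χ.conductor)]
  · refine Finset.sum_le_sum fun d hd => ?_
    have hdn : d ∣ n := Nat.dvd_of_mem_divisors (Finset.mem_of_mem_erase hd)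
    have hval : ∀ χ : DirichletCharacter ℂ d,
        charSum A (DirichletCharacter.changeLevel hdn χ) = charSum A χ := by
      intro χ
      refine Finset.sum_congr rfl fun p hp => ?_
      have := DirichletCharacter.changeLevel_eq_cast_of_dvd' χ hdn (a := p)
        (Nat.isCoprime_iff_coprime.2 (hAn p hp))
      simpa using this
    have hprim : primMoment A k d = ∑ χ ∈ primitiveChars d,
        ‖charSum A (DirichletCharacter.changeLevel hdn χ)‖ ^ k :=
      Finset.sum_congr rfl fun χ _ => by rw [hval χ]
    rw [hprim, ← Finset.sum_image (f := fun χ => ‖charSum A χ‖ ^ k)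
      (g := fun χ => DirichletCharacter.changeLevel hdn χ)
      ((DirichletCharacter.changeLevel_injective hdn).injOn)]
    refine Finset.sum_le_sum_of_subset_of_nonneg ?_ fun _ _ _ => by positivity
    intro χ hχ
    obtain ⟨-, rfl⟩ := Finset.mem_filter.1 hχ
    refine Finset.mem_image.2 ⟨χ.primitiveCharacter, ?_, χ.changeLevel_primitiveCharacter⟩
    exact Finset.mem_filter.2 ⟨Finset.mem_univ _, χ.primitiveCharacter_isPrimitive⟩
  · intro χ hχ
    refine Finset.mem_erase.2 ⟨?_, Nat.mem_divisors.2 ⟨χ.conductor_dvd_level, hn.ne'⟩⟩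
    rw [Ne, ← DirichletCharacter.eq_one_iff_conductor_eq_one]
    exact (Finset.mem_erase.1 hχ).1

theorem abs_card_modEq_one_sub_le {A : Finset ℕ} {n : ℕ} (hn : 0 < n)
    (hAn : ∀ p ∈ A, p.Coprime n) (k : ℕ) :
    |(((tuples A k).filter fun x => ∏ i, x i ≡ 1 [MOD n]).card : ℝ) -
        (A.card : ℝ) ^ k / n.totient| ≤
      (∑ d ∈ n.divisors.erase 1, primMoment A k d) / n.totient := by
  have : NeZero n := ⟨hn.ne'⟩
  have hφ : (0 : ℝ) < n.totient := by exact_mod_cast Nat.totient_pos.2 hn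
  set R := ((tuples A k).filter fun x => ∏ i, x i ≡ 1 [MOD n]).card with hR
  have h1 : ∑ χ : DirichletCharacter ℂ n, charSum A χ ^ k = n.totient * R := by
    simp_rw [charSum_pow]
    rw [Finset.sum_comm]
    simp_rw [DirichletCharacter.sum_characters_eq]
    rw [hR, ← Finset.sum_filter, Finset.sum_const, nsmul_eq_mul, mul_comm]
    congr 3
    refine Finset.filter_congr fun x _ => ?_
    rw [← ZMod.natCast_eq_natCast_iff, Nat.cast_one]
  have h2 : charSum A (1 : DirichletCharacter ℂ n) = A.card := by
    rw [charSum, Finset.sum_congr rfl (g := fun _ => (1 : ℂ)) fun p hp => ?_]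
    · simp
    · exact MulChar.one_apply ((ZMod.isUnit_iff_coprime p n).2 (hAn p hp))
  classical
  rw [← Finset.add_sum_erase _ _ (Finset.mem_univ (1 : DirichletCharacter ℂ n)), h2] at h1
  have h3 : ‖((n.totient * R - (A.card : ℝ) ^ k : ℝ) : ℂ)‖ ≤
      ∑ d ∈ n.divisors.erase 1, primMoment A k d := by
    have : ((n.totient * R - (A.card : ℝ) ^ k : ℝ) : ℂ) =
        ∑ χ ∈ (Finset.univ : Finset (DirichletCharacter ℂ n)).erase 1, charSum A χ ^ k := by
      push_cast
      rw [← h1]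
      ring
    rw [this]
    refine (norm_sum_le _ _).trans ?_
    simp_rw [norm_pow]
    exact sum_char_ne_one_le hn hAn k
  rw [Complex.norm_real, Real.norm_eq_abs] at h3
  have h4 : (R : ℝ) - (A.card : ℝ) ^ k / n.totient =
      (n.totient * R - (A.card : ℝ) ^ k) / n.totient := by
    field_simp
  rw [h4, abs_div, abs_of_pos hφ]
  gcongr

/-! ### Expanding the count in characters -/

theorem sum_tuples_succ {M : Type*} [AddCommMonoid M] (B : Finset ℕ) (r : ℕ)
    (G : (Fin (r + 1) → ℕ) → M) :
    ∑ q ∈ tuples B (r + 1), G q = ∑ p ∈ B, ∑ q ∈ tuples B r, G (Fin.cons p q) := by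
  rw [← Finset.sum_product']
  refine Finset.sum_bij' (fun q _ => (q 0, Fin.tail q)) (fun z _ => Fin.cons z.1 z.2) ?_ ?_ ?_ ?_ ?_
  · intro q hq
    rw [mem_tuples] at hq
    exact Finset.mem_product.2 ⟨hq 0, mem_tuples.2 fun i => hq i.succ⟩
  · intro z hz
    obtain ⟨h1, h2⟩ := Finset.mem_product.1 hz
    exact mem_tuples.2 (Fin.cases h1 (mem_tuples.1 h2))
  · intro q _
    exact Fin.cons_self_tail q
  · intro z _
    simp
  · intro q _
    rw [Fin.cons_self_tail]

/-- The sum of `F n / n` over the products `n = q₁ ⋯ q_r` of `r`-tuples from `B`. -/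
noncomputable def wsum (B : Finset ℕ) (r : ℕ) (F : ℕ → ℝ) : ℝ :=
  ∑ q ∈ tuples B r, F (∏ j, q j) / ((∏ j, q j : ℕ) : ℝ)

theorem wsum_zero (B : Finset ℕ) (F : ℕ → ℝ) : wsum B 0 F = F 1 := by
  simp [wsum, tuples]

theorem wsum_succ (B : Finset ℕ) (r : ℕ) (F : ℕ → ℝ) :
    wsum B (r + 1) F = ∑ p ∈ B, 1 / (p : ℝ) * wsum B r fun n => F (p * n) := by
  rw [wsum, sum_tuples_succ]
  refine Finset.sum_congr rfl fun p _ => ?_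
  rw [wsum, Finset.mul_sum]
  refine Finset.sum_congr rfl fun q _ => ?_
  rw [Fin.prod_cons, Nat.cast_mul, one_div_mul_eq_div, div_div, mul_comm (p : ℝ)]

theorem wsum_mono {B : Finset ℕ} {r : ℕ} {F G : ℕ → ℝ}
    (h : ∀ q ∈ tuples B r, F (∏ j, q j) ≤ G (∏ j, q j)) : wsum B r F ≤ wsum B r G :=
  Finset.sum_le_sum fun q hq => div_le_div_of_nonneg_right (h q hq) (Nat.cast_nonneg _)

theorem wsum_add (B : Finset ℕ) (r : ℕ) (F G : ℕ → ℝ) :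
    wsum B r (fun n => F n + G n) = wsum B r F + wsum B r G := by
  simp only [wsum, add_div, Finset.sum_add_distrib]

theorem wsum_const_mul (B : Finset ℕ) (r : ℕ) (c : ℝ) (F : ℕ → ℝ) :
    wsum B r (fun n => c * F n) = c * wsum B r F := by
  simp only [wsum, mul_div_assoc, Finset.mul_sum]

theorem wsum_nonneg (B : Finset ℕ) (r : ℕ) {F : ℕ → ℝ} (hF : ∀ n, 0 ≤ F n) : 0 ≤ wsum B r F :=
  Finset.sum_nonneg fun _ _ => div_nonneg (hF _) (Nat.cast_nonneg _)

theorem wsum_one (B : Finset ℕ) (r : ℕ) :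
    wsum B r (fun _ => 1) = (∑ q ∈ B, 1 / (q : ℝ)) ^ r := by
  induction r with
  | zero => simp [wsum_zero]
  | succ r ih => rw [wsum_succ, ← Finset.sum_mul, ih, pow_succ']

theorem sum_divisors_prime_mul_le {p n : ℕ} (hp : p.Prime) (hn : n ≠ 0) {F : ℕ → ℝ}
    (hF : ∀ n, 0 ≤ F n) :
    ∑ d ∈ (p * n).divisors, F d ≤ ∑ d ∈ n.divisors, F d + ∑ d ∈ n.divisors, F (p * d) := by
  have hsub : (p * n).divisors ⊆ n.divisors ∪ n.divisors.image fun d => p * d := by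
    intro d hd
    have hdn := Nat.dvd_of_mem_divisors hd
    by_cases hpd : p ∣ d
    · obtain ⟨e, rfl⟩ := hpd
      refine Finset.mem_union_right _ (Finset.mem_image_of_mem _ ?_)
      exact Nat.mem_divisors.2 ⟨Nat.dvd_of_mul_dvd_mul_left hp.pos hdn, hn⟩
    · refine Finset.mem_union_left _ (Nat.mem_divisors.2 ⟨?_, hn⟩)
      exact (((Nat.Prime.coprime_iff_not_dvd hp).2 hpd).symm).dvd_of_dvd_mul_left hdn
  calc ∑ d ∈ (p * n).divisors, F d
      ≤ ∑ d ∈ n.divisors ∪ n.divisors.image fun d => p * d, F d :=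
        Finset.sum_le_sum_of_subset_of_nonneg hsub fun _ _ _ => hF _
    _ ≤ ∑ d ∈ n.divisors, F d + ∑ d ∈ n.divisors.image fun d => p * d, F d := by
        rw [← Finset.sum_union_inter]
        exact le_add_of_nonneg_right (Finset.sum_nonneg fun _ _ => hF _)
    _ = _ := by
        rw [Finset.sum_image]
        exact fun a _ b _ h => Nat.eq_of_mul_eq_mul_left hp.pos h

/-- Summing over the divisors of `q₁ ⋯ q_l` costs at most the sum over all subproducts. -/
theorem wsum_sum_divisors_le {B : Finset ℕ} (hB : ∀ q ∈ B, q.Prime) (l : ℕ) {F : ℕ → ℝ}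
    (hF : ∀ n, 0 ≤ F n) :
    wsum B l (fun n => ∑ d ∈ n.divisors, F d) ≤
      ∑ r ∈ Finset.range (l + 1), l.choose r * (∑ q ∈ B, 1 / (q : ℝ)) ^ (l - r) * wsum B r F := by
  set L := ∑ q ∈ B, 1 / (q : ℝ) with hL
  induction l generalizing F with
  | zero => simp [wsum_zero]
  | succ l ih =>
    have h1 : wsum B (l + 1) (fun n => ∑ d ∈ n.divisors, F d) ≤
        ∑ p ∈ B, 1 / (p : ℝ) * (wsum B l (fun n => ∑ d ∈ n.divisors, F d) +
          wsum B l fun n => ∑ d ∈ n.divisors, F (p * d)) := by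
      rw [wsum_succ]
      refine Finset.sum_le_sum fun p hp => mul_le_mul_of_nonneg_left ?_ (by positivity)
      rw [← wsum_add]
      exact wsum_mono fun q hq =>
        sum_divisors_prime_mul_le (hB p hp) (prod_pos_of_mem_tuples hB hq).ne' hF
    have h2 : ∑ p ∈ B, 1 / (p : ℝ) * (wsum B l fun n => ∑ d ∈ n.divisors, F (p * d)) ≤
        ∑ r ∈ Finset.range (l + 1), l.choose r * L ^ (l - r) * wsum B (r + 1) F := by
      calc _ ≤ ∑ p ∈ B, 1 / (p : ℝ) * ∑ r ∈ Finset.range (l + 1), l.choose r * L ^ (l - r) *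
              wsum B r fun n => F (p * n) := by
            refine Finset.sum_le_sum fun p _ => mul_le_mul_of_nonneg_left ?_ (by positivity)
            exact ih fun n => hF (p * n)
        _ = _ := by
            simp_rw [wsum_succ, Finset.mul_sum]
            rw [Finset.sum_comm]
            refine Finset.sum_congr rfl fun r _ => Finset.sum_congr rfl fun p _ => ?_
            ring
    have h3 : L * wsum B l (fun n => ∑ d ∈ n.divisors, F d) ≤
        ∑ r ∈ Finset.range (l + 1), l.choose r * L ^ (l + 1 - r) * wsum B r F := by
      have hL0 : 0 ≤ L := Finset.sum_nonneg fun _ _ => by positivity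
      refine (mul_le_mul_of_nonneg_left (ih hF) hL0).trans_eq ?_
      rw [Finset.mul_sum]
      refine Finset.sum_congr rfl fun r hr => ?_
      rw [Nat.succ_sub (Nat.le_of_lt_succ (Finset.mem_range.1 hr)), pow_succ']
      ring
    simp_rw [mul_add, Finset.sum_add_distrib, ← Finset.sum_mul] at h1
    refine (h1.trans (add_le_add h3 h2)).trans_eq ?_
    -- Pascal's rule.
    rw [Finset.sum_range_succ' _ (l + 1), Finset.sum_range_succ']
    simp_rw [Nat.choose_succ_succ, Nat.add_sub_add_right]
    rw [Finset.sum_range_succ _ l]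
    push_cast
    simp_rw [add_mul, Finset.sum_add_distrib]
    rw [Finset.sum_range_succ _ l, Finset.sum_range_succ (fun r => (l.choose (r + 1) : ℝ) * _ * _)]
    simp
    ring

/-- The expansion of the count in characters: the main term comes from the principal characters,
and the remaining characters are sorted by the number `r` of prime factors of their conductor. -/
theorem abs_card_sub_le {A B : Finset ℕ} (hB : ∀ q ∈ B, q.Prime)
    (hAB : ∀ p ∈ A, ∀ q ∈ B, p.Coprime q) (k l : ℕ) {κ : ℝ} (hκ : 0 ≤ κ)
    (hφ : ∀ q ∈ tuples B l, ((∏ j, q j : ℕ) : ℝ) ≤ κ * (∏ j, q j).totient) :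
    |(((tuples A k ×ˢ tuples B l).filter fun x => ∏ i, x.1 i ≡ 1 [MOD ∏ j, x.2 j]).card : ℝ) -
        (∑ q ∈ B, 1 / (q : ℝ)) ^ l * (A.card : ℝ) ^ k| ≤
      (κ - 1) * ((∑ q ∈ B, 1 / (q : ℝ)) ^ l * (A.card : ℝ) ^ k) +
      κ * ∑ r ∈ Finset.Icc 1 l, l.choose r * (∑ q ∈ B, 1 / (q : ℝ)) ^ (l - r) *
        wsum B r (primMoment A k) := by
  set L := ∑ q ∈ B, 1 / (q : ℝ) with hL
  set P := (A.card : ℝ) with hP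
  set F : ℕ → ℝ := fun d => if d = 1 then 0 else primMoment A k d with hF
  have hF0 : ∀ d, 0 ≤ F d := by
    intro d
    rw [hF]
    dsimp only
    split_ifs
    exacts [le_rfl, primMoment_nonneg A k d]
  have hFle : ∀ d, F d ≤ primMoment A k d := by
    intro d
    rw [hF]
    dsimp only
    split_ifs
    exacts [primMoment_nonneg A k d, le_rfl]
  have hcard : (((tuples A k ×ˢ tuples B l).filter
      fun x => ∏ i, x.1 i ≡ 1 [MOD ∏ j, x.2 j]).card : ℝ) =
      ∑ q ∈ tuples B l, (((tuples A k).filter fun x => ∏ i, x i ≡ 1 [MOD ∏ j, q j]).card : ℝ) := by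
    rw [Finset.card_filter, Finset.sum_product_right]
    push_cast
    simp only [Finset.card_filter, Nat.cast_sum, Nat.cast_ite, Nat.cast_one, Nat.cast_zero]
  have hmain : L ^ l * P ^ k = ∑ q ∈ tuples B l, P ^ k / ((∏ j, q j : ℕ) : ℝ) := by
    rw [hL, ← wsum_one, wsum, Finset.sum_mul]
    exact Finset.sum_congr rfl fun q _ => by ring
  have hterm : ∀ q ∈ tuples B l,
      |(((tuples A k).filter fun x => ∏ i, x i ≡ 1 [MOD ∏ j, q j]).card : ℝ) -
        P ^ k / ((∏ j, q j : ℕ) : ℝ)| ≤ (κ - 1) * (P ^ k / ((∏ j, q j : ℕ) : ℝ)) +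
        κ * ((∑ d ∈ (∏ j, q j).divisors, F d) / ((∏ j, q j : ℕ) : ℝ)) := by
    intro q hq
    have hn := prod_pos_of_mem_tuples hB hq
    have hq' := hφ q hq
    set n := ∏ j, q j with hnq
    have hAn : ∀ p ∈ A, p.Coprime n := fun p hp =>
      Nat.Coprime.prod_right fun j _ => hAB p hp _ (mem_tuples.1 hq j)
    have h1 := abs_card_modEq_one_sub_le hn hAn k
    have h2 : ∑ d ∈ n.divisors.erase 1, primMoment A k d = ∑ d ∈ n.divisors, F d := by
      rw [← Finset.sum_erase n.divisors (f := F) (a := 1) (by simp [hF])]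
      refine Finset.sum_congr rfl fun d hd => ?_
      simp [hF, (Finset.mem_erase.1 hd).1]
    rw [h2] at h1
    set G := ∑ d ∈ n.divisors, F d with hG
    have hG0 : 0 ≤ G := Finset.sum_nonneg fun _ _ => hF0 _
    have hn0 : (0 : ℝ) < n := by exact_mod_cast hn
    have hφ0 : (0 : ℝ) < n.totient := by exact_mod_cast Nat.totient_pos.2 hn
    have hφn : (n.totient : ℝ) ≤ n := by exact_mod_cast Nat.totient_le n
    have hinv : 1 / (n.totient : ℝ) ≤ κ * (1 / n) := by
      rw [mul_one_div, div_le_div_iff₀ hφ0 hn0, one_mul]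
      exact hq'
    have hPk : 0 ≤ P ^ k := by positivity
    have h3 : P ^ k / n ≤ P ^ k / n.totient := by gcongr
    have h4 : P ^ k / n.totient ≤ κ * (P ^ k / n) := by
      have := mul_le_mul_of_nonneg_left hinv hPk
      calc P ^ k / n.totient = P ^ k * (1 / n.totient) := by ring
        _ ≤ _ := this
        _ = _ := by ring
    have h5 : G / n.totient ≤ κ * (G / n) := by
      have := mul_le_mul_of_nonneg_left hinv hG0
      calc G / n.totient = G * (1 / n.totient) := by ring
        _ ≤ _ := this
        _ = _ := by ring
    rw [abs_le] at h1 ⊢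
    constructor <;> nlinarith [h1.1, h1.2]
  have hdiv : ∑ q ∈ tuples B l, (∑ d ∈ (∏ j, q j).divisors, F d) / ((∏ j, q j : ℕ) : ℝ) ≤
      ∑ r ∈ Finset.Icc 1 l, l.choose r * L ^ (l - r) * wsum B r (primMoment A k) := by
    refine (wsum_sum_divisors_le hB l hF0).trans ?_
    have hL0 : 0 ≤ L := Finset.sum_nonneg fun _ _ => by positivity
    have hz : Finset.range (l + 1) = insert 0 (Finset.Icc 1 l) := by
      ext r
      simp only [Finset.mem_range, Finset.mem_insert, Finset.mem_Icc]
      omega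
    rw [hz, Finset.sum_insert (by simp), wsum_zero]
    simp only [hF, if_true, mul_zero, zero_add]
    refine Finset.sum_le_sum fun r _ => mul_le_mul_of_nonneg_left ?_ (by positivity)
    exact wsum_mono fun q _ => hFle _
  rw [hcard, hmain, ← Finset.sum_sub_distrib]
  refine (Finset.abs_sum_le_sum_abs _ _).trans ((Finset.sum_le_sum hterm).trans ?_)
  rw [Finset.sum_add_distrib, ← Finset.mul_sum, ← Finset.mul_sum]
  gcongr

/-- Each modulus `d` is the product of at most `r!` tuples and is at least `(y / 4) ^ r`, so the
large sieve over the set of moduli bounds the weighted sum over tuples. -/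
theorem wsum_primMoment_le_of_largeSieve {A B : Finset ℕ} {y : ℝ} (hy : 1 ≤ y)
    (hA : ∀ p ∈ A, p.Prime) (hAy : ∀ p ∈ A, (p : ℝ) ≤ y) (hB : ∀ q ∈ B, q.Prime)
    (hBy : ∀ q ∈ B, y / 4 ≤ (q : ℝ) ∧ (q : ℝ) ≤ y) (r : ℕ) :
    wsum B r (primMoment A (4 * r)) ≤
      28 * (4 * y) ^ r * r.factorial * (2 * r).factorial * (A.card : ℝ) ^ (2 * r) := by
  have hy0 : 0 < y := by linarith
  have h1 : wsum B r (primMoment A (4 * r)) ≤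
      (4 / y) ^ r * ∑ q ∈ tuples B r, primMoment A (4 * r) (∏ j, q j) := by
    rw [wsum, Finset.mul_sum]
    refine Finset.sum_le_sum fun q hq => ?_
    have hq0 : (0 : ℝ) < ((∏ j, q j : ℕ) : ℝ) := by exact_mod_cast prod_pos_of_mem_tuples hB hq
    have h2 : (y / 4) ^ r ≤ ((∏ j, q j : ℕ) : ℝ) := by
      push_cast
      calc (y / 4) ^ r = ∏ _j : Fin r, y / 4 := by
            rw [Finset.prod_const, Finset.card_univ, Fintype.card_fin]
        _ ≤ _ := Finset.prod_le_prod (fun _ _ => by positivity)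
          fun j _ => (hBy _ (mem_tuples.1 hq j)).1
    rw [div_eq_mul_inv, mul_comm]
    refine mul_le_mul_of_nonneg_right ?_ (primMoment_nonneg _ _ _)
    rw [← inv_div y 4, inv_pow]
    gcongr
  set D := (tuples B r).image fun q => ∏ j, q j with hD
  have h2 : ∑ q ∈ tuples B r, primMoment A (4 * r) (∏ j, q j) ≤
      r.factorial * ∑ d ∈ D, primMoment A (4 * r) d := by
    rw [← Finset.sum_fiberwise_of_maps_to (s := tuples B r) (t := D)
      (g := fun q => ∏ j, q j) (fun x hx => Finset.mem_image_of_mem _ hx), Finset.mul_sum]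
    refine Finset.sum_le_sum fun d _ => ?_
    rw [Finset.sum_congr rfl (g := fun _ => primMoment A (4 * r) d)
      fun x hx => by rw [(Finset.mem_filter.1 hx).2], Finset.sum_const, nsmul_eq_mul]
    refine mul_le_mul_of_nonneg_right ?_ (primMoment_nonneg _ _ _)
    exact_mod_cast card_filter_prod_eq_le hB r d
  have h3 : ∑ d ∈ D, primMoment A (4 * r) d ≤
      28 * y ^ (2 * r) * ((2 * r).factorial * (A.card : ℝ) ^ (2 * r)) := by
    have hDM : ∀ d ∈ D, 0 < d ∧ (d : ℝ) ≤ y ^ r := by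
      intro d hd
      obtain ⟨q, hq, rfl⟩ := Finset.mem_image.1 hd
      refine ⟨prod_pos_of_mem_tuples hB hq, ?_⟩
      push_cast
      calc ∏ j, (q j : ℝ) ≤ ∏ _j : Fin r, y :=
            Finset.prod_le_prod (fun _ _ => by positivity) fun j _ => (hBy _ (mem_tuples.1 hq j)).2
        _ = y ^ r := by simp
    have h4 := sum_primMoment_le hA hAy hy0 (one_le_pow₀ hy) hDM (2 * r)
    rw [← mul_assoc] at h4
    refine h4.trans (mul_le_mul_of_nonneg_right ?_ (by positivity))
    have h5 : (0 : ℝ) < y ^ (2 * r) := by positivity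
    rw [← pow_mul, mul_comm r 2]
    nlinarith [Real.pi_lt_d2]
  calc wsum B r (primMoment A (4 * r))
      ≤ (4 / y) ^ r * (r.factorial *
        (28 * y ^ (2 * r) * ((2 * r).factorial * (A.card : ℝ) ^ (2 * r)))) := by
        refine h1.trans (mul_le_mul_of_nonneg_left (h2.trans ?_) (by positivity))
        gcongr
    _ = _ := by
        rw [div_pow, mul_pow 4 y, pow_mul y, sq, mul_pow y y]
        field_simp

theorem wsum_primMoment_le_of_orthogonality {A B : Finset ℕ} {y : ℝ} (hy : 1 ≤ y)
    (hA : ∀ p ∈ A, p.Prime) (hAy : ∀ p ∈ A, (p : ℝ) ≤ y) (hB : ∀ q ∈ B, q.Prime)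
    (hBy : ∀ q ∈ B, (q : ℝ) ≤ y) (hAB : ∀ p ∈ A, ∀ q ∈ B, p.Coprime q) (r : ℕ) :
    wsum B r (primMoment A (2 * r)) ≤
      2 * (A.card : ℝ) ^ r * r.factorial * ((∑ q ∈ B, 1 / (q : ℝ)) * y) ^ r := by
  have hy0 : 0 < y := by linarith
  have h1 : ∀ q ∈ tuples B r, primMoment A (2 * r) (∏ j, q j) ≤
      2 * (A.card : ℝ) ^ r * r.factorial * y ^ r * 1 := by
    intro q hq
    refine (primMoment_le hA hAy hy0 (prod_pos_of_mem_tuples hB hq)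
      (fun p hp => Nat.Coprime.prod_right fun j _ => hAB p hp _ (mem_tuples.1 hq j)) r).trans ?_
    have h2 : ((∏ j, q j : ℕ) : ℝ) ≤ y ^ r := by
      push_cast
      calc ∏ j, (q j : ℝ) ≤ ∏ _j : Fin r, y :=
            Finset.prod_le_prod (fun _ _ => by positivity) fun j _ => hBy _ (mem_tuples.1 hq j)
        _ = y ^ r := by simp
    have h3 : (0 : ℝ) ≤ (A.card : ℝ) ^ r * r.factorial := by positivity
    nlinarith
  refine (wsum_mono (G := fun _ => 2 * (A.card : ℝ) ^ r * r.factorial * y ^ r * 1) h1).trans_eq ?_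
  rw [wsum_const_mul, wsum_one, mul_pow]
  ring

/-! ### Primes in dyadic intervals and factorials -/

theorem mem_primesIoc {a b : ℝ} {p : ℕ} :
    p ∈ primesIoc a b ↔ p.Prime ∧ a < (p : ℝ) ∧ (p : ℝ) ≤ b := by
  rw [primesIoc, Finset.mem_filter, Finset.mem_range, Nat.lt_succ_iff, and_iff_right_iff_imp]
  rintro ⟨-, -, h⟩
  exact Nat.le_floor h

/-- The primes `p` with `n < p ≤ 2 * n`. -/
def dyadicPrimes (n : ℕ) : Finset ℕ := (Finset.Ioc n (2 * n)).filter Nat.Prime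

/-- The primes in `(n, 2n]` divide the central binomial coefficient, which is at most `4 ^ n`. -/
theorem pow_card_dyadicPrimes_le (n : ℕ) : n ^ (dyadicPrimes n).card ≤ 4 ^ n := by
  have hdvd : ∏ p ∈ dyadicPrimes n, p ∣ n.centralBinom := by
    refine Finset.prod_primes_dvd _ (fun p hp => (Finset.mem_filter.1 hp).2.prime) fun p hp => ?_
    obtain ⟨hp, hpp⟩ := Finset.mem_filter.1 hp
    obtain ⟨h1, h2⟩ := Finset.mem_Ioc.1 hp
    have h3 : p ∣ (2 * n).factorial := (hpp.dvd_factorial).2 h2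
    rw [← Nat.choose_mul_factorial_mul_factorial (show n ≤ 2 * n by omega),
      show 2 * n - n = n by omega] at h3
    have h4 : ¬p ∣ n.factorial := fun h => absurd ((hpp.dvd_factorial).1 h) (by omega)
    exact ((hpp.dvd_mul.1 ((hpp.dvd_mul.1 h3).resolve_right h4)).resolve_right h4)
  calc n ^ (dyadicPrimes n).card = ∏ _p ∈ dyadicPrimes n, n := by simp
    _ ≤ ∏ p ∈ dyadicPrimes n, p := Finset.prod_le_prod' fun p hp =>
        (Finset.mem_Ioc.1 (Finset.mem_filter.1 hp).1).1.le
    _ ≤ n.centralBinom := Nat.le_of_dvd n.centralBinom_pos hdvd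
    _ ≤ 4 ^ n := by
        rw [Nat.centralBinom]
        calc (2 * n).choose n ≤ 2 ^ (2 * n) := Nat.choose_le_two_pow _ _
          _ = 4 ^ n := by rw [pow_mul]; norm_num

/-- The estimate behind Bertrand's postulate: primes in `(2n/3, n]` do not divide the central
binomial coefficient, those in `(√(2n), 2n/3]` divide it at most once, and every prime power
dividing it is at most `2n`. -/
theorem centralBinom_le_dyadicPrimes {n : ℕ} (hn : 2 < n) :
    n.centralBinom ≤ (2 * n) ^ Nat.sqrt (2 * n) * 4 ^ (2 * n / 3) *
      (2 * n) ^ (dyadicPrimes n).card := by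
  have n2_pos : 1 ≤ 2 * n := by omega
  set f : ℕ → ℕ := fun p => p ^ n.centralBinom.factorization p with hf
  have hle : ∀ p, f p ≤ 2 * n := fun p => Nat.pow_factorization_choose_le (by omega)
  set S := (Finset.range (2 * n + 1)).filter Nat.Prime with hS
  have h1 : n.centralBinom = ∏ p ∈ S, f p := by
    rw [← Nat.prod_pow_factorization_centralBinom n]
    refine (Finset.prod_filter_of_ne fun p _ h => ?_).symm
    by_contra hp
    exact h (by simp [Nat.factorization_eq_zero_of_not_prime _ hp])
  set S₁ := S.filter fun p => p ≤ Nat.sqrt (2 * n)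
  set S₂ := S.filter fun p => ¬p ≤ Nat.sqrt (2 * n)
  have h2 : ∏ p ∈ S₁, f p ≤ (2 * n) ^ Nat.sqrt (2 * n) := by
    refine (Finset.prod_le_prod' fun p _ => hle p).trans ?_
    rw [Finset.prod_const]
    refine Nat.pow_le_pow_right n2_pos ?_
    calc S₁.card ≤ (Finset.Icc 1 (Nat.sqrt (2 * n))).card := Finset.card_le_card fun p hp => by
          obtain ⟨h1, h2⟩ := Finset.mem_filter.1 hp
          exact Finset.mem_Icc.2 ⟨(Finset.mem_filter.1 h1).2.one_lt.le, h2⟩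
      _ = Nat.sqrt (2 * n) := by simp
  have h3 : ∏ p ∈ S₂.filter (fun p => p ≤ n), f p ≤ 4 ^ (2 * n / 3) := by
    refine le_trans ?_ (primorial_le_four_pow (2 * n / 3))
    have hsmall : ∀ p ∈ S₂.filter (fun p => p ≤ n), f p ≤ if p ≤ 2 * n / 3 then p else 1 := by
      intro p hp
      obtain ⟨hp, hpn⟩ := Finset.mem_filter.1 hp
      obtain ⟨hp, hps⟩ := Finset.mem_filter.1 hp
      have hpp := (Finset.mem_filter.1 hp).2
      split_ifs with h
      · refine (Nat.pow_le_pow_right hpp.one_lt.le ?_).trans (pow_one p).le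
        exact Nat.factorization_choose_le_one (Nat.sqrt_lt'.mp <| not_le.1 hps)
      · rw [hf]
        dsimp only
        rw [Nat.factorization_centralBinom_of_two_mul_self_lt_three_mul hn hpn (by omega), pow_zero]
    refine (Finset.prod_le_prod' hsmall).trans ?_
    rw [← Finset.prod_filter, primorial]
    refine Finset.prod_le_prod_of_subset_of_one_le' (fun p hp => ?_)
      fun p hp _ => (Finset.mem_filter.1 hp).2.one_lt.le
    obtain ⟨hp, h⟩ := Finset.mem_filter.1 hp
    have hpp := (Finset.mem_filter.1 (Finset.mem_filter.1 (Finset.mem_filter.1 hp).1).1).2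
    exact Finset.mem_filter.2 ⟨Finset.mem_range.2 (by omega), hpp⟩
  have h4 : ∏ p ∈ S₂.filter (fun p => ¬p ≤ n), f p ≤ (2 * n) ^ (dyadicPrimes n).card := by
    refine (Finset.prod_le_prod' fun p _ => hle p).trans ?_
    rw [Finset.prod_const]
    refine Nat.pow_le_pow_right n2_pos (Finset.card_le_card fun p hp => ?_)
    obtain ⟨hp, hpn⟩ := Finset.mem_filter.1 hp
    obtain ⟨hp, hpp⟩ := Finset.mem_filter.1 (Finset.mem_filter.1 hp).1
    have := Finset.mem_range.1 hp
    exact Finset.mem_filter.2 ⟨Finset.mem_Ioc.2 ⟨by omega, by omega⟩, hpp⟩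
  rw [h1, ← Finset.prod_filter_mul_prod_filter_not S (fun p => p ≤ Nat.sqrt (2 * n)), mul_assoc,
    ← Finset.prod_filter_mul_prod_filter_not S₂ (fun p => p ≤ n)]
  exact Nat.mul_le_mul h2 (Nat.mul_le_mul h3 h4)

theorem card_dyadicPrimes_mul_log_le {n : ℕ} (hn : 0 < n) :
    (dyadicPrimes n).card * Real.log n ≤ n * Real.log 4 := by
  have hn0 : (0 : ℝ) < n := by exact_mod_cast hn
  have h : (n : ℝ) ^ (dyadicPrimes n).card ≤ (4 : ℝ) ^ n := by
    exact_mod_cast pow_card_dyadicPrimes_le n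
  have := Real.log_le_log (by positivity) h
  rwa [Real.log_pow, Real.log_pow] at this

theorem le_card_dyadicPrimes_mul_log {n : ℕ} (hn : 4 ≤ n) :
    n * Real.log 4 / 3 - (√(2 * n) + 1) * Real.log (2 * n) ≤
      (dyadicPrimes n).card * Real.log (2 * n) := by
  have hn0 : (0 : ℝ) < n := by exact_mod_cast (by omega : 0 < n)
  set T := (dyadicPrimes n).card with hT
  have h1 : 4 ^ n ≤ (2 * n) * ((2 * n) ^ Nat.sqrt (2 * n) * 4 ^ (2 * n / 3) * (2 * n) ^ T) := by
    refine (Nat.four_pow_lt_mul_centralBinom n hn).le.trans ?_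
    exact Nat.mul_le_mul (by omega) (centralBinom_le_dyadicPrimes (by omega))
  have h2 : (4 : ℝ) ^ n ≤
      (2 * n) * ((2 * n) ^ Nat.sqrt (2 * n) * 4 ^ (2 * n / 3) * (2 * n) ^ T) := by
    exact_mod_cast h1
  have h3 := Real.log_le_log (by positivity) h2
  rw [Real.log_mul (x := 2 * n) (by positivity) (by positivity),
    Real.log_mul (y := (2 * n) ^ T) (by positivity) (by positivity),
    Real.log_mul (y := 4 ^ (2 * n / 3)) (by positivity) (by positivity), Real.log_pow,
    Real.log_pow, Real.log_pow, Real.log_pow] at h3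
  have h4 : ((2 * n / 3 : ℕ) : ℝ) ≤ 2 * n / 3 := by
    have := Nat.cast_div_le (α := ℝ) (m := 2 * n) (n := 3)
    push_cast at this
    exact this
  have h5 : ((Nat.sqrt (2 * n) : ℕ) : ℝ) ≤ √(2 * n) := by
    have := Real.nat_sqrt_le_real_sqrt (a := 2 * n)
    push_cast at this
    exact this
  have h6 : 0 ≤ Real.log (2 * n) := Real.log_nonneg (by
    have : (4 : ℝ) ≤ n := by exact_mod_cast hn
    linarith)
  have h7 : 0 ≤ Real.log 4 := Real.log_nonneg (by norm_num)
  have h8 := mul_le_mul_of_nonneg_right h4 h7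
  have h9 := mul_le_mul_of_nonneg_right h5 h6
  linarith

theorem dyadicPrimes_subset_primesIoc {x : ℝ} (hx : 0 ≤ x) :
    dyadicPrimes ⌊x⌋₊ ⊆ primesIoc x (2 * x) := by
  intro p hp
  obtain ⟨hp, hpp⟩ := Finset.mem_filter.1 hp
  obtain ⟨h1, h2⟩ := Finset.mem_Ioc.1 hp
  refine mem_primesIoc.2 ⟨hpp, (Nat.floor_lt hx).1 h1, ?_⟩
  have h3 : (p : ℝ) ≤ 2 * ⌊x⌋₊ := by exact_mod_cast h2
  linarith [Nat.floor_le hx]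

theorem card_primesIoc_le {x : ℝ} (hx : 0 ≤ x) :
    (primesIoc x (2 * x)).card ≤ (dyadicPrimes ⌊x⌋₊).card + 1 := by
  refine (Finset.card_le_card ?_).trans (Finset.card_insert_le (2 * ⌊x⌋₊ + 1) _)
  intro p hp
  obtain ⟨hpp, h1, h2⟩ := mem_primesIoc.1 hp
  have h3 : ⌊x⌋₊ < p := (Nat.floor_lt hx).2 h1
  have h4 : (p : ℝ) < ((2 * ⌊x⌋₊ + 2 : ℕ) : ℝ) := by
    push_cast
    linarith [Nat.lt_floor_add_one x]
  have h5 : p < 2 * ⌊x⌋₊ + 2 := by exact_mod_cast h4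
  rw [Finset.mem_insert, dyadicPrimes, Finset.mem_filter, Finset.mem_Ioc]
  by_cases h : p = 2 * ⌊x⌋₊ + 1
  · exact Or.inl h
  · exact Or.inr ⟨⟨h3, by omega⟩, hpp⟩

open Filter in
theorem eventually_log_le_mul {c : ℝ} (hc : 0 < c) : ∀ᶠ x : ℝ in atTop, Real.log x ≤ c * x := by
  filter_upwards [Real.isLittleO_log_id_atTop.bound hc, eventually_ge_atTop 1] with x hx hx1
  simpa [abs_of_nonneg (Real.log_nonneg hx1), abs_of_nonneg (zero_le_one.trans hx1)] using hx

open Filter in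
theorem eventually_sqrt_mul_log_le_mul {c : ℝ} (hc : 0 < c) :
    ∀ᶠ x : ℝ in atTop, (√x + 1) * Real.log x ≤ c * x := by
  have h := (isLittleO_log_rpow_atTop (show (0 : ℝ) < 1 / 2 by norm_num)).bound
    (show 0 < c / 2 by linarith)
  filter_upwards [h, eventually_ge_atTop 1] with x hx hx1
  rw [Real.norm_of_nonneg (Real.log_nonneg hx1), ← Real.sqrt_eq_rpow,
    Real.norm_of_nonneg (Real.sqrt_nonneg x)] at hx
  have h1 : 1 ≤ √x := Real.one_le_sqrt.2 hx1
  have h2 : √x * √x = x := Real.mul_self_sqrt (by linarith)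
  have h3 : (√x + 1) * Real.log x ≤ (2 * √x) * (c / 2 * √x) :=
    mul_le_mul (by linarith) hx (Real.log_nonneg hx1) (by positivity)
  nlinarith

theorem log_four_gt : (1.386 : ℝ) < Real.log 4 := by
  rw [show (4 : ℝ) = 2 ^ 2 by norm_num, Real.log_pow]
  have := Real.log_two_gt_d9
  norm_num at this ⊢
  linarith

theorem log_four_lt : Real.log 4 < (1.387 : ℝ) := by
  rw [show (4 : ℝ) = 2 ^ 2 by norm_num, Real.log_pow]
  have := Real.log_two_lt_d9
  norm_num at this ⊢
  linarith

open Filter in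
theorem eventually_card_primesIoc_ge :
    ∀ᶠ x : ℝ in atTop, 0.45 * x ≤ (primesIoc x (2 * x)).card * Real.log (2 * x) := by
  have h1 : Tendsto (fun x : ℝ => 2 * x) atTop atTop :=
    tendsto_id.const_mul_atTop (by norm_num)
  filter_upwards [h1.eventually (eventually_sqrt_mul_log_le_mul (show (0 : ℝ) < 0.005 by norm_num)),
    eventually_ge_atTop 1000] with x hx hx1
  have hx0 : 0 ≤ x := by linarith
  have hn : 4 ≤ ⌊x⌋₊ := Nat.le_floor (by norm_num; linarith)
  have h2 := le_card_dyadicPrimes_mul_log hn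
  set n := ⌊x⌋₊
  have hn4 : (4 : ℝ) ≤ n := by exact_mod_cast hn
  have hnx : (n : ℝ) ≤ x := Nat.floor_le hx0
  have hxn : x - 1 ≤ n := (Nat.sub_one_lt_floor x).le
  have h3 : Real.log (2 * n) ≤ Real.log (2 * x) := Real.log_le_log (by linarith) (by linarith)
  have h4 : √(2 * n) ≤ √(2 * x) := Real.sqrt_le_sqrt (by linarith)
  have h5 : 0 ≤ Real.log (2 * n) := Real.log_nonneg (by linarith)
  have h6 : (√(2 * n) + 1) * Real.log (2 * n) ≤ (√(2 * x) + 1) * Real.log (2 * x) := by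
    gcongr
  have h7 : ((dyadicPrimes n).card : ℝ) * Real.log (2 * n) ≤
      (primesIoc x (2 * x)).card * Real.log (2 * x) := by
    have : ((dyadicPrimes n).card : ℝ) ≤ (primesIoc x (2 * x)).card := by
      exact_mod_cast Finset.card_le_card (dyadicPrimes_subset_primesIoc hx0)
    gcongr
  nlinarith [log_four_gt]

open Filter in
theorem eventually_card_primesIoc_le :
    ∀ᶠ x : ℝ in atTop, (primesIoc x (2 * x)).card * Real.log (2 * x) ≤ 1.5 * x := by
  have h1 : Tendsto (fun x : ℝ => Real.log (2 * x)) atTop atTop :=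
    Real.tendsto_log_atTop.comp (tendsto_id.const_mul_atTop (by norm_num))
  filter_upwards [eventually_log_le_mul (show (0 : ℝ) < 0.01 by norm_num),
    h1.eventually_ge_atTop 40, eventually_ge_atTop 1000] with x hx hlog hx1
  have hx0 : 0 ≤ x := by linarith
  have hn : 0 < ⌊x⌋₊ := Nat.floor_pos.2 (by linarith)
  have h2 := card_dyadicPrimes_mul_log_le hn
  have h3 : ((primesIoc x (2 * x)).card : ℝ) ≤ (dyadicPrimes ⌊x⌋₊).card + 1 := by
    exact_mod_cast card_primesIoc_le hx0
  set n := ⌊x⌋₊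
  have hnx : (n : ℝ) ≤ x := Nat.floor_le hx0
  have hxn : x - 1 ≤ n := (Nat.sub_one_lt_floor x).le
  have h4 : Real.log (2 * x) - Real.log 4 ≤ Real.log n := by
    rw [← Real.log_div (by positivity) (by norm_num)]
    exact Real.log_le_log (by positivity) (by linarith)
  have h5 : Real.log n ≤ Real.log x := Real.log_le_log (by exact_mod_cast hn) hnx
  have h6 := log_four_lt
  set T := ((dyadicPrimes n).card : ℝ)
  set c := ((primesIoc x (2 * x)).card : ℝ)
  have hc : 0 ≤ c := Nat.cast_nonneg _
  have h7 : 0.96 * Real.log (2 * x) ≤ Real.log n := by linarith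
  have h8 : c * (0.96 * Real.log (2 * x)) ≤ c * Real.log n := mul_le_mul_of_nonneg_left h7 hc
  have h9 : c * Real.log n ≤ (T + 1) * Real.log n :=
    mul_le_mul_of_nonneg_right h3 (by linarith)
  have h10 : (n : ℝ) * Real.log 4 ≤ x * 1.387 :=
    mul_le_mul hnx h6.le (Real.log_nonneg (by norm_num)) hx0
  linarith

/-- A weak form of Stirling's upper bound, `n! ≤ e n (n / e) ^ n`. -/
theorem factorial_mul_exp_pow_le {n : ℕ} (hn : 1 ≤ n) :
    (n.factorial : ℝ) * Real.exp 1 ^ n ≤ Real.exp 1 * n * (n : ℝ) ^ n := by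
  induction n, hn using Nat.le_induction with
  | base => simp
  | succ n hn ih =>
    have hn0 : (0 : ℝ) < n := by exact_mod_cast hn
    have h1 : Real.exp 1 * (n : ℝ) ^ (n + 1) ≤ ((n : ℝ) + 1) ^ (n + 1) := by
      have h2 : (n : ℝ) ≤ (n + 1) * Real.exp (-(1 / (n + 1))) := by
        have := Real.add_one_le_exp (-(1 / ((n : ℝ) + 1)))
        have h3 : ((n : ℝ) + 1) * (-(1 / (n + 1)) + 1) = n := by
          field_simp
          ring
        calc (n : ℝ) = ((n : ℝ) + 1) * (-(1 / (n + 1)) + 1) := h3.symm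
          _ ≤ _ := mul_le_mul_of_nonneg_left this (by positivity)
      have h4 := pow_le_pow_left₀ hn0.le h2 (n + 1)
      rw [mul_pow, ← Real.exp_nat_mul] at h4
      have h5 : ((n + 1 : ℕ) : ℝ) * -(1 / ((n : ℝ) + 1)) = -1 := by
        push_cast
        field_simp
      rw [h5] at h4
      calc Real.exp 1 * (n : ℝ) ^ (n + 1)
          ≤ Real.exp 1 * (((n : ℝ) + 1) ^ (n + 1) * Real.exp (-1)) := by gcongr
        _ = ((n : ℝ) + 1) ^ (n + 1) := by
          rw [mul_left_comm, ← Real.exp_add]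
          simp
    rw [Nat.factorial_succ]
    push_cast
    calc ((n : ℝ) + 1) * n.factorial * Real.exp 1 ^ (n + 1)
        = ((n : ℝ) + 1) * Real.exp 1 * (n.factorial * Real.exp 1 ^ n) := by ring
      _ ≤ ((n : ℝ) + 1) * Real.exp 1 * (Real.exp 1 * n * (n : ℝ) ^ n) := by gcongr
      _ = ((n : ℝ) + 1) * Real.exp 1 * (Real.exp 1 * (n : ℝ) ^ (n + 1)) := by ring
      _ ≤ ((n : ℝ) + 1) * Real.exp 1 * ((n : ℝ) + 1) ^ (n + 1) := by gcongr
      _ = _ := by ring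

theorem mul_pow_le_inv_one_sub {x : ℝ} (hx0 : 0 < x) (hx1 : x < 1) (n : ℕ) :
    n * x ^ n ≤ 1 / (1 - x) := by
  have h1 : 1 + (n : ℝ) * (x⁻¹ - 1) ≤ (1 + (x⁻¹ - 1)) ^ n :=
    one_add_mul_le_pow (by linarith [inv_pos.2 hx0]) n
  rw [add_sub_cancel, inv_pow] at h1
  have hxn : 0 < x ^ n := by positivity
  have h3 : 0 < 1 - x := by linarith
  have h2 : (n : ℝ) * (1 - x) ≤ (x ^ n)⁻¹ := by
    have h4 : 1 - x ≤ x⁻¹ - 1 := by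
      have : x⁻¹ - 1 = (1 - x) / x := by field_simp
      rw [this, le_div_iff₀ hx0]
      nlinarith
    have h5 : (n : ℝ) * (1 - x) ≤ n * (x⁻¹ - 1) := mul_le_mul_of_nonneg_left h4 (Nat.cast_nonneg n)
    linarith
  rw [le_div_iff₀ h3]
  calc n * x ^ n * (1 - x) = n * (1 - x) * x ^ n := by ring
    _ ≤ (x ^ n)⁻¹ * x ^ n := by gcongr
    _ = 1 := inv_mul_cancel₀ hxn.ne'

/-! ### Bounds for the individual error terms -/

theorem choose_mul_factorial_le_pow (l r : ℕ) : (l.choose r : ℝ) * r.factorial ≤ (l : ℝ) ^ r := by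
  have h : l.choose r * r.factorial ≤ l ^ r := by
    rw [mul_comm, ← Nat.descFactorial_eq_factorial_mul_choose]
    exact Nat.descFactorial_le_pow l r
  exact_mod_cast h

theorem choose_mul_factorial_le_factorial {l r : ℕ} (h : r ≤ l) :
    (l.choose r : ℝ) * r.factorial ≤ l.factorial := by
  have h : l.choose r * r.factorial ≤ l.factorial := by
    rw [← Nat.choose_mul_factorial_mul_factorial h]
    exact Nat.le_mul_of_pos_right _ (Nat.factorial_pos _)
  exact_mod_cast h

theorem primMoment_le_pow_mul (A : Finset ℕ) {j k : ℕ} (h : j ≤ k) (d : ℕ) :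
    primMoment A k d ≤ (A.card : ℝ) ^ (k - j) * primMoment A j d := by
  rw [primMoment, primMoment, Finset.mul_sum]
  refine Finset.sum_le_sum fun χ _ => ?_
  rw [← pow_sub_mul_pow _ h]
  have := norm_charSum_le A χ
  gcongr

theorem pow_le_interpolate {x Z : ℝ} (hx : 0 ≤ x) (hZ : 0 < Z) {i k j : ℕ} (hik : i ≤ k)
    (hkj : k ≤ j) : x ^ k ≤ Z ^ (k - i) * x ^ i + (Z ^ (j - k))⁻¹ * x ^ j := by
  rcases le_total x Z with h | h
  · have h1 : x ^ k ≤ Z ^ (k - i) * x ^ i := by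
      rw [← pow_sub_mul_pow x hik]
      gcongr
    have h2 : 0 ≤ (Z ^ (j - k))⁻¹ * x ^ j := by positivity
    linarith
  · have hx0 : 0 < x := hZ.trans_le h
    have h1 : x ^ k ≤ (Z ^ (j - k))⁻¹ * x ^ j := by
      rw [← pow_sub_mul_pow x hkj, ← mul_assoc, le_mul_iff_one_le_left (by positivity),
        ← div_eq_inv_mul, one_le_div (by positivity)]
      gcongr
    have h2 : 0 ≤ Z ^ (k - i) * x ^ i := by positivity
    linarith

/-- A substitute for Hölder's inequality between moments, with the free parameter `Z`
separating small from large character sums. -/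
theorem primMoment_le_interpolate (A : Finset ℕ) {Z : ℝ} (hZ : 0 < Z) {i k j : ℕ} (hik : i ≤ k)
    (hkj : k ≤ j) (d : ℕ) :
    primMoment A k d ≤
      Z ^ (k - i) * primMoment A i d + (Z ^ (j - k))⁻¹ * primMoment A j d := by
  simp only [primMoment, Finset.mul_sum, ← Finset.sum_add_distrib]
  exact Finset.sum_le_sum fun χ _ => pow_le_interpolate (norm_nonneg _) hZ hik hkj

/-- The terms with `4 * r ≤ k`: here `W` stands for the weighted `k`-th moment, `a` for `λ` and `L`
for `log y`. -/
theorem largeSieve_term_le {l r k : ℕ} (hr : 1 ≤ r) (hrl : r ≤ l) (hrk : 4 * r ≤ k)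
    {a P y L W : ℝ} (ha : 0 < a) (hP : 0 < P) (hy : 0 < y) (hL : 1 ≤ L)
    (hW : W ≤ P ^ (k - 4 * r) *
      (28 * (4 * y) ^ r * r.factorial * (2 * r).factorial * P ^ (2 * r)))
    (h : 16 * (l : ℝ) ^ 3 * y * (2 * L) ≤ a * P ^ 2) :
    l.choose r * a ^ (l - r) * W ≤ 28 * (a ^ l * P ^ k * (1 / L)) * (1 / 2) ^ r := by
  have hL0 : 0 < L := by linarith
  have h1 : ((2 * r).factorial : ℝ) ≤ (4 * (l : ℝ) ^ 2) ^ r := by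
    have h2 : (2 * r).factorial ≤ (2 * r) ^ (2 * r) := Nat.factorial_le_pow _
    calc ((2 * r).factorial : ℝ) ≤ (2 * r) ^ (2 * r) := by exact_mod_cast h2
      _ ≤ (2 * l) ^ (2 * r) := by gcongr
      _ = (4 * (l : ℝ) ^ 2) ^ r := by rw [pow_mul]; ring
  have h3 : (16 * (l : ℝ) ^ 3 * y) ^ r ≤ (a * P ^ 2) ^ r * (1 / L) * (1 / 2) ^ r := by
    obtain ⟨s, rfl⟩ : ∃ s, r = s + 1 := ⟨r - 1, by omega⟩
    have h4 : 16 * (l : ℝ) ^ 3 * y ≤ a * P ^ 2 * (1 / L) * (1 / 2) := by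
      rw [mul_one_div, mul_one_div, div_div, le_div_iff₀ (by positivity)]
      linarith
    have h5 : 16 * (l : ℝ) ^ 3 * y ≤ a * P ^ 2 * (1 / 2) := by
      refine h4.trans ?_
      have : 1 / L ≤ 1 := (div_le_one hL0).2 hL
      have h6 : 0 < a * P ^ 2 := by positivity
      nlinarith
    calc (16 * (l : ℝ) ^ 3 * y) ^ (s + 1)
        = (16 * (l : ℝ) ^ 3 * y) ^ s * (16 * (l : ℝ) ^ 3 * y) := pow_succ _ _
      _ ≤ (a * P ^ 2 * (1 / 2)) ^ s * (a * P ^ 2 * (1 / L) * (1 / 2)) := by gcongr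
      _ = _ := by ring
  have hc := choose_mul_factorial_le_pow l r
  calc l.choose r * a ^ (l - r) * W
      ≤ l.choose r * a ^ (l - r) * (P ^ (k - 4 * r) *
        (28 * (4 * y) ^ r * r.factorial * (2 * r).factorial * P ^ (2 * r))) := by gcongr
    _ = 28 * a ^ (l - r) * P ^ (k - 4 * r) * P ^ (2 * r) * (4 * y) ^ r *
        (l.choose r * r.factorial) * (2 * r).factorial := by ring
    _ ≤ 28 * a ^ (l - r) * P ^ (k - 4 * r) * P ^ (2 * r) * (4 * y) ^ r *
        (l : ℝ) ^ r * (4 * (l : ℝ) ^ 2) ^ r := by gcongr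
    _ = 28 * a ^ (l - r) * P ^ (k - 4 * r) * P ^ (2 * r) * (16 * (l : ℝ) ^ 3 * y) ^ r := by
        have : (16 * (l : ℝ) ^ 3 * y) ^ r = (4 * y) ^ r * (l : ℝ) ^ r * (4 * (l : ℝ) ^ 2) ^ r := by
          rw [← mul_pow, ← mul_pow]
          ring
        rw [this]
        ring
    _ ≤ 28 * a ^ (l - r) * P ^ (k - 4 * r) * P ^ (2 * r) *
        ((a * P ^ 2) ^ r * (1 / L) * (1 / 2) ^ r) := by gcongr
    _ = 28 * ((a ^ (l - r) * a ^ r) * (P ^ (k - 4 * r) * P ^ (4 * r)) * (1 / L)) *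
        (1 / 2) ^ r := by
        rw [mul_pow a, ← pow_mul P, show 4 * r = 2 * r + 2 * r by ring, pow_add P (2 * r) (2 * r)]
        ring
    _ = _ := by rw [pow_sub_mul_pow a hrl, pow_sub_mul_pow P hrk]

/-- The constant `2.5` exceeds `16 / e ^ 2`, which leaves a geometric factor to absorb the linear
factor in Stirling's bound. -/
theorem four_pow_mul_factorial_le {l r : ℕ} (hr : 1 ≤ r) (hrl : r ≤ l) :
    (4 : ℝ) ^ r * (2 * r).factorial ≤ 44 * (2.5 * (l : ℝ) ^ 2) ^ r := by
  have he := Real.exp_one_gt_d9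
  have he' := Real.exp_one_lt_d9
  have h1 := factorial_mul_exp_pow_le (n := 2 * r) (by omega)
  have h2 := mul_pow_le_inv_one_sub (x := 0.87) (by norm_num) (by norm_num) r
  have h3 : (7.385 : ℝ) ≤ Real.exp 1 ^ 2 := by nlinarith
  push_cast at h1
  rw [pow_mul (Real.exp 1), pow_mul (2 * (r : ℝ))] at h1
  have h4 : ((2 * r).factorial : ℝ) * 7.385 ^ r ≤
      Real.exp 1 * (2 * r) * ((2 * (l : ℝ)) ^ 2) ^ r := by
    calc ((2 * r).factorial : ℝ) * 7.385 ^ r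
        ≤ (2 * r).factorial * (Real.exp 1 ^ 2) ^ r := by gcongr
      _ ≤ Real.exp 1 * (2 * r) * ((2 * (r : ℝ)) ^ 2) ^ r := h1
      _ ≤ _ := by gcongr
  refine le_of_mul_le_mul_right ?_ (show (0 : ℝ) < 7.385 ^ r by positivity)
  calc (4 : ℝ) ^ r * (2 * r).factorial * 7.385 ^ r
      = 4 ^ r * ((2 * r).factorial * 7.385 ^ r) := by ring
    _ ≤ 4 ^ r * (Real.exp 1 * (2 * r) * ((2 * (l : ℝ)) ^ 2) ^ r) := by gcongr
    _ = 2 * Real.exp 1 * r * (16 * (l : ℝ) ^ 2) ^ r := by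
        have : (16 * (l : ℝ) ^ 2) ^ r = 4 ^ r * ((2 * (l : ℝ)) ^ 2) ^ r := by
          rw [← mul_pow]
          ring
        rw [this]
        ring
    _ ≤ 2 * Real.exp 1 * r * (0.87 * (2.5 * (l : ℝ) ^ 2) * 7.385) ^ r := by
        refine mul_le_mul_of_nonneg_left (pow_le_pow_left₀ (by positivity) ?_ r) (by positivity)
        nlinarith [sq_nonneg (l : ℝ)]
    _ = 2 * Real.exp 1 * (r * 0.87 ^ r) * ((2.5 * (l : ℝ) ^ 2) ^ r * 7.385 ^ r) := by
        rw [mul_pow, mul_pow 0.87]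
        ring
    _ ≤ 44 * ((2.5 * (l : ℝ) ^ 2) ^ r * 7.385 ^ r) := by
        refine mul_le_mul_of_nonneg_right ?_ (by positivity)
        norm_num at h2 ⊢
        nlinarith
    _ = _ := by ring

/-- Here `2.96 ^ 2 < 4 * e`, which leaves a geometric factor to absorb the linear factor in
Stirling's bound; `2.96 ^ 2` in turn exceeds `2.5 * 3.5`. -/
theorem factorial_mul_pow_le {l : ℕ} (hl : 1 ≤ l) :
    (l.factorial : ℝ) * 2.96 ^ (2 * l) ≤ 15 * (4 * l) ^ l := by
  have he := Real.exp_one_gt_d9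
  have he' := Real.exp_one_lt_d9
  have h1 := factorial_mul_exp_pow_le hl
  have h2 := mul_pow_le_inv_one_sub (x := 0.81) (by norm_num) (by norm_num) l
  refine le_of_mul_le_mul_right ?_ (show (0 : ℝ) < Real.exp 1 ^ l by positivity)
  calc (l.factorial : ℝ) * 2.96 ^ (2 * l) * Real.exp 1 ^ l
      = l.factorial * Real.exp 1 ^ l * (2.96 ^ 2) ^ l := by rw [← pow_mul]; ring
    _ ≤ Real.exp 1 * l * (l : ℝ) ^ l * (0.81 * (4 * Real.exp 1)) ^ l := by
        gcongr
        linarith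
    _ = Real.exp 1 * (l * 0.81 ^ l) * ((4 * (l : ℝ)) ^ l * Real.exp 1 ^ l) := by
        rw [mul_pow, mul_pow, mul_pow]
        ring
    _ ≤ 15 * ((4 * (l : ℝ)) ^ l * Real.exp 1 ^ l) := by
        refine mul_le_mul_of_nonneg_right ?_ (by positivity)
        norm_num at h2 ⊢
        nlinarith
    _ = _ := by ring

/-- The terms with `2 * r ≤ k ≤ 4 * r`: here `W` stands for the weighted `k`-th moment, `a` for `λ`
and `w` for `√y`. The choice of `Z` balances the two moments. -/
theorem interpolated_term_le {l r k : ℕ} (hr : 1 ≤ r) (hrl : r ≤ l) (hlk : 2 * l ≤ k)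
    (hkr : k ≤ 4 * r) {a P w Z W : ℝ} (ha : 0 < a) (hP : 0 < P) (hw : 0 < w) (hZ : 0 < Z)
    (hZ2 : Z ^ 2 = 2.5 * P * (l : ℝ) ^ 2 / a)
    (hW : W ≤ Z ^ (k - 2 * r) * (2 * P ^ r * r.factorial * (a * w ^ 2) ^ r) +
      (Z ^ (4 * r - k))⁻¹ *
        (28 * (4 * w ^ 2) ^ r * r.factorial * (2 * r).factorial * P ^ (2 * r)))
    (hPa : P ≤ 3.5 * a * w ^ 2) (hla : 5 * (l : ℝ) ^ 2 ≤ a * w ^ 2) :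
    l.choose r * a ^ (l - r) * W ≤
      20000 * ((l : ℝ) ^ (k - l) * (4 * a * P) ^ l * w ^ k) * (1 / 2) ^ (l - r) := by
  have hl0 : (0 : ℝ) < l := by exact_mod_cast (by omega : 0 < l)
  have hsecond : (Z ^ (4 * r - k))⁻¹ *
      (28 * (4 * w ^ 2) ^ r * r.factorial * (2 * r).factorial * P ^ (2 * r)) ≤
      1232 * (Z ^ (k - 2 * r) * (r.factorial * (a * P * w ^ 2) ^ r)) := by
    rw [inv_mul_le_iff₀ (by positivity)]
    have h1 : Z ^ (4 * r - k) * Z ^ (k - 2 * r) = (2.5 * P * (l : ℝ) ^ 2 / a) ^ r := by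
      rw [← pow_add, show 4 * r - k + (k - 2 * r) = 2 * r by omega, pow_mul, hZ2]
    have h2 := four_pow_mul_factorial_le hr hrl
    calc 28 * (4 * w ^ 2) ^ r * r.factorial * (2 * r).factorial * P ^ (2 * r)
        = 28 * r.factorial * (w ^ 2) ^ r * P ^ (2 * r) * (4 ^ r * (2 * r).factorial) := by
          rw [mul_pow 4]
          ring
      _ ≤ 28 * r.factorial * (w ^ 2) ^ r * P ^ (2 * r) * (44 * (2.5 * (l : ℝ) ^ 2) ^ r) := by
          gcongr
      _ = 1232 * (r.factorial * (2.5 * P * (l : ℝ) ^ 2 / a * (a * P * w ^ 2)) ^ r) := by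
          have : 2.5 * P * (l : ℝ) ^ 2 / a * (a * P * w ^ 2) =
              w ^ 2 * P ^ 2 * (2.5 * (l : ℝ) ^ 2) := by
            field_simp
          rw [this, mul_pow (w ^ 2 * P ^ 2), mul_pow (w ^ 2), ← pow_mul P]
          ring
      _ = Z ^ (4 * r - k) * (1232 * (Z ^ (k - 2 * r) * (r.factorial * (a * P * w ^ 2) ^ r))) := by
          rw [mul_pow (2.5 * P * (l : ℝ) ^ 2 / a), ← h1]
          ring
  have hW' : W ≤ 1300 * (Z ^ (k - 2 * r) * (r.factorial * (a * P * w ^ 2) ^ r)) := by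
    have h1 : Z ^ (k - 2 * r) * (2 * P ^ r * r.factorial * (a * w ^ 2) ^ r) =
        2 * (Z ^ (k - 2 * r) * (r.factorial * (a * P * w ^ 2) ^ r)) := by
      rw [show a * P * w ^ 2 = P * (a * w ^ 2) by ring, mul_pow P]
      ring
    have h2 : 0 ≤ Z ^ (k - 2 * r) * (r.factorial * (a * P * w ^ 2) ^ r) := by positivity
    rw [h1] at hW
    linarith
  have hZs : Z ^ (k - 2 * r) * a ^ (l - r) ≤
      Z ^ (k - 2 * l) * (a * P * w ^ 2 * (1 / 2)) ^ (l - r) := by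
    rw [show k - 2 * r = k - 2 * l + 2 * (l - r) by omega, pow_add, pow_mul, mul_assoc, ← mul_pow,
      hZ2]
    have : 2.5 * P * (l : ℝ) ^ 2 / a * a ≤ a * P * w ^ 2 * (1 / 2) := by
      rw [div_mul_cancel₀ _ ha.ne']
      nlinarith
    gcongr
  have hZle : Z ≤ 2.96 * (l * w) := by
    refine le_of_sq_le_sq ?_ (by positivity)
    rw [hZ2, div_le_iff₀ ha]
    have h1 : 2.5 * P * (l : ℝ) ^ 2 ≤ 2.5 * (3.5 * a * w ^ 2) * (l : ℝ) ^ 2 := by gcongr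
    have h2 : 0 < a * w ^ 2 * (l : ℝ) ^ 2 := by positivity
    nlinarith
  have hZk : Z ^ (k - 2 * l) ≤ 2.96 ^ (2 * l) * (l * w) ^ (k - 2 * l) := by
    calc Z ^ (k - 2 * l) ≤ (2.96 * (l * w)) ^ (k - 2 * l) := by gcongr
      _ = 2.96 ^ (k - 2 * l) * (l * w) ^ (k - 2 * l) := mul_pow _ _ _
      _ ≤ _ := by
        gcongr
        · norm_num
        · omega
  have hc := choose_mul_factorial_le_factorial hrl
  have hlf := factorial_mul_pow_le (show 1 ≤ l by omega)
  calc l.choose r * a ^ (l - r) * W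
      ≤ l.choose r * a ^ (l - r) *
        (1300 * (Z ^ (k - 2 * r) * (r.factorial * (a * P * w ^ 2) ^ r))) := by gcongr
    _ = 1300 * (l.choose r * r.factorial) * (Z ^ (k - 2 * r) * a ^ (l - r)) *
        (a * P * w ^ 2) ^ r := by ring
    _ ≤ 1300 * l.factorial * (Z ^ (k - 2 * l) * (a * P * w ^ 2 * (1 / 2)) ^ (l - r)) *
        (a * P * w ^ 2) ^ r := by gcongr
    _ = 1300 * l.factorial * Z ^ (k - 2 * l) *
        ((a * P * w ^ 2) ^ (l - r) * (a * P * w ^ 2) ^ r) * (1 / 2) ^ (l - r) := by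
        rw [mul_pow (a * P * w ^ 2)]
        ring
    _ = 1300 * l.factorial * Z ^ (k - 2 * l) * (a * P * w ^ 2) ^ l * (1 / 2) ^ (l - r) := by
        rw [pow_sub_mul_pow _ hrl]
    _ ≤ 1300 * l.factorial * (2.96 ^ (2 * l) * (l * w) ^ (k - 2 * l)) *
        (a * P * w ^ 2) ^ l * (1 / 2) ^ (l - r) := by gcongr
    _ = 1300 * (l.factorial * 2.96 ^ (2 * l)) * (l * w) ^ (k - 2 * l) *
        (a * P * w ^ 2) ^ l * (1 / 2) ^ (l - r) := by ring
    _ ≤ 1300 * (15 * (4 * l) ^ l) * (l * w) ^ (k - 2 * l) *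
        (a * P * w ^ 2) ^ l * (1 / 2) ^ (l - r) := by gcongr
    _ = 19500 * ((l : ℝ) ^ (k - l) * (4 * a * P) ^ l * w ^ k) * (1 / 2) ^ (l - r) := by
        have h1 : (l : ℝ) ^ (k - l) = (l : ℝ) ^ l * (l : ℝ) ^ (k - 2 * l) := by
          rw [← pow_add]
          congr 1
          omega
        have h2 : w ^ k = (w ^ 2) ^ l * w ^ (k - 2 * l) := by
          rw [← pow_mul, ← pow_add]
          congr 1
          omega
        rw [h1, h2, mul_pow (l : ℝ) w, mul_pow 4 (l : ℝ), mul_pow (a * P), mul_pow (4 * a),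
          mul_pow a, mul_pow 4 a]
        ring
    _ ≤ _ := by
        gcongr
        norm_num

/-! ### Assembling the estimate -/

theorem sum_half_pow_le (l : ℕ) : ∑ r ∈ Finset.Icc 1 l, (1 / 2 : ℝ) ^ r ≤ 2 := by
  refine le_trans (Finset.sum_le_sum_of_subset_of_nonneg ?_ fun _ _ _ => by positivity)
    (sum_geometric_two_le (l + 1))
  intro r hr
  exact Finset.mem_range.2 (Nat.lt_succ_of_le (Finset.mem_Icc.1 hr).2)

theorem sum_half_pow_sub_le (l : ℕ) : ∑ r ∈ Finset.Icc 1 l, (1 / 2 : ℝ) ^ (l - r) ≤ 2 := by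
  have h := sum_geometric_two_le (l + 1)
  rw [← Finset.sum_range_reflect] at h
  refine le_trans (Finset.sum_le_sum_of_subset_of_nonneg ?_ fun _ _ _ => by positivity) h
  intro r hr
  exact Finset.mem_range.2 (Nat.lt_succ_of_le (Finset.mem_Icc.1 hr).2)

theorem prod_le_mul_totient {B : Finset ℕ} {y : ℝ} (hB : ∀ q ∈ B, q.Prime)
    (hBy : ∀ q ∈ B, y / 4 ≤ (q : ℝ)) (hy : 4 ≤ y) {l : ℕ} {ε : ℝ} (hε0 : 0 ≤ ε) (hε1 : ε ≤ 1)
    (hl : 8 * l ≤ ε * y) {q : Fin l → ℕ} (hq : q ∈ tuples B l) :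
    ((∏ j, q j : ℕ) : ℝ) ≤ (1 + ε) * (∏ j, q j).totient := by
  have hy0 : 0 < y := by linarith
  have htot : ∀ s : Finset (Fin l), ∏ j ∈ s, (q j).totient ≤ (∏ j ∈ s, q j).totient := by
    intro s
    induction s using Finset.induction_on with
    | empty => simp
    | insert i s hi ih =>
      rw [Finset.prod_insert hi, Finset.prod_insert hi]
      exact (Nat.mul_le_mul_left _ ih).trans (Nat.totient_super_multiplicative _ _)
  have h1 : ∏ j, ((1 - 4 / y) * (q j : ℝ)) ≤ ((∏ j, q j).totient : ℝ) := by
    refine le_trans ?_ (Nat.cast_le.2 (htot Finset.univ))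
    push_cast
    refine Finset.prod_le_prod (fun j _ => ?_) fun j _ => ?_
    · have : 4 / y ≤ 1 := (div_le_one hy0).2 hy
      have : 0 ≤ 1 - 4 / y := by linarith
      positivity
    · have hj := mem_tuples.1 hq j
      rw [Nat.totient_prime (hB _ hj), Nat.cast_sub (hB _ hj).one_lt.le, Nat.cast_one]
      have := hBy _ hj
      have h2 : 1 ≤ 4 / y * q j := by
        rw [div_mul_eq_mul_div, le_div_iff₀ hy0]
        linarith
      linarith
  rw [Finset.prod_mul_distrib, Finset.prod_const, Finset.card_univ, Fintype.card_fin] at h1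
  have h2 : 1 + (l : ℝ) * (-(4 / y)) ≤ (1 + -(4 / y)) ^ l := by
    refine one_add_mul_le_pow ?_ l
    have : 4 / y ≤ 1 := (div_le_one hy0).2 hy
    linarith
  have h3 : (l : ℝ) * (4 / y) ≤ ε / 2 := by
    rw [mul_div_assoc', div_le_iff₀ hy0]
    linarith
  have h4 : 1 ≤ (1 + ε) * (1 - 4 / y) ^ l := by
    have h5 : 1 - ε / 2 ≤ (1 - 4 / y) ^ l := by
      rw [sub_eq_add_neg 1 (4 / y)]
      linarith
    nlinarith
  have h5 : (0 : ℝ) ≤ ∏ j, (q j : ℝ) := Finset.prod_nonneg fun _ _ => by positivity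
  push_cast
  calc ∏ j, (q j : ℝ) ≤ (1 + ε) * (1 - 4 / y) ^ l * ∏ j, (q j : ℝ) :=
        le_mul_of_one_le_left h5 h4
    _ = (1 + ε) * ((1 - 4 / y) ^ l * ∏ j, (q j : ℝ)) := by ring
    _ ≤ _ := by gcongr

theorem solCount_eq (y : ℝ) (k l : ℕ) : solCount y k l =
    ((tuples (primesIoc (y / 2) y) k ×ˢ tuples (primesIoc (y / 4) (y / 2)) l).filter
      fun x => ∏ i, x.1 i ≡ 1 [MOD ∏ j, x.2 j]).card := rfl

/-- The estimate for large `y`, with explicit constants. -/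
theorem abs_solCount_sub_le {y : ℝ} {k l : ℕ} (hl : 1 ≤ l) (hlk : 2 * l ≤ k)
    (hL : 20 ≤ Real.log y) (hy : 4 ≤ y) (hk : (k : ℝ) ^ 3 * Real.log y ^ 6 ≤ y)
    (hPl : 0.225 * y ≤ primeCount y * Real.log y) (hPu : primeCount y * Real.log y ≤ 0.75 * y)
    (hlam : 0.225 ≤ lam y * Real.log y) :
    (4 * l ≤ k → |(solCount y k l : ℝ) - lam y ^ l * primeCount y ^ k| ≤
      113 * (lam y ^ l * primeCount y ^ k * (1 / Real.log y))) ∧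
    (k ≤ 4 * l → |(solCount y k l : ℝ) - lam y ^ l * primeCount y ^ k| ≤
      113 * (lam y ^ l * primeCount y ^ k * (1 / Real.log y)) +
      80000 * ((l : ℝ) ^ (k - l) * (4 * lam y * primeCount y) ^ l * √y ^ k)) := by
  set A := primesIoc (y / 2) y with hA
  set B := primesIoc (y / 4) (y / 2) with hB
  set L := Real.log y with hLdef
  set P := primeCount y with hPdef
  set a := lam y with hadef
  have hy0 : 0 < y := by linarith
  have hL0 : 0 < L := by linarith
  have hP0 : 0 < P := pos_of_mul_pos_left (by linarith : 0 < P * L) hL0.le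
  have ha0 : 0 < a := pos_of_mul_pos_left (by linarith : 0 < a * L) hL0.le
  have hAp : ∀ p ∈ A, p.Prime := fun p hp => (mem_primesIoc.1 hp).1
  have hBp : ∀ q ∈ B, q.Prime := fun q hq => (mem_primesIoc.1 hq).1
  have hAy : ∀ p ∈ A, (p : ℝ) ≤ y := fun p hp => (mem_primesIoc.1 hp).2.2
  have hBy1 : ∀ q ∈ B, y / 4 ≤ (q : ℝ) := fun q hq => (mem_primesIoc.1 hq).2.1.le
  have hBy2 : ∀ q ∈ B, (q : ℝ) ≤ y := fun q hq => by
    linarith [(mem_primesIoc.1 hq).2.2]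
  have hAB : ∀ p ∈ A, ∀ q ∈ B, p.Coprime q := by
    intro p hp q hq
    refine (Nat.coprime_primes (hAp p hp) (hBp q hq)).2 ?_
    rintro rfl
    linarith [(mem_primesIoc.1 hp).2.1, (mem_primesIoc.1 hq).2.2]
  have hl1 : (1 : ℝ) ≤ l := by exact_mod_cast hl
  have hl3 : 8 * (l : ℝ) ^ 3 * L ^ 6 ≤ y := by
    refine le_trans ?_ hk
    have : 2 * (l : ℝ) ≤ k := by exact_mod_cast hlk
    calc 8 * (l : ℝ) ^ 3 * L ^ 6 = (2 * (l : ℝ)) ^ 3 * L ^ 6 := by ring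
      _ ≤ _ := by gcongr
  have hL5 : (20 : ℝ) ^ 5 ≤ L ^ 5 := by gcongr
  have hL2 : (20 : ℝ) ^ 2 ≤ L ^ 2 := by gcongr
  have hll3 : (l : ℝ) ≤ (l : ℝ) ^ 3 := le_self_pow₀ hl1 (by norm_num)
  have hl23 : (l : ℝ) ^ 2 ≤ (l : ℝ) ^ 3 := pow_le_pow_right₀ hl1 (by norm_num)
  have hl3L : (20 : ℝ) ^ 5 * ((l : ℝ) ^ 3 * L) ≤ y / 8 := by
    have : 0 ≤ (l : ℝ) ^ 3 * L := by positivity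
    calc (20 : ℝ) ^ 5 * ((l : ℝ) ^ 3 * L) ≤ L ^ 5 * ((l : ℝ) ^ 3 * L) := by gcongr
      _ = 8 * (l : ℝ) ^ 3 * L ^ 6 / 8 := by ring
      _ ≤ y / 8 := by gcongr
  have hl3L0 : 0 ≤ (l : ℝ) ^ 3 * L := by positivity
  have hε : 8 * (l : ℝ) ≤ 1 / L * y := by
    rw [one_div_mul_eq_div, le_div_iff₀ hL0]
    have : (l : ℝ) * L ≤ (l : ℝ) ^ 3 * L := by gcongr
    linarith
  have hmainsize : 16 * (l : ℝ) ^ 3 * y * (2 * L) ≤ a * P ^ 2 := by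
    refine le_of_mul_le_mul_right ?_ (show 0 < L ^ 5 by positivity)
    have h1 : 16 * (l : ℝ) ^ 3 * y * (2 * L) * L ^ 5 = 4 * y * (8 * (l : ℝ) ^ 3 * L ^ 6) := by ring
    have h2 : 0.225 * (0.225 * y) ^ 2 ≤ a * L * (P * L) ^ 2 := by gcongr
    have h3 : a * P ^ 2 * L ^ 5 = a * L * (P * L) ^ 2 * L ^ 2 := by ring
    rw [h1, h3]
    calc 4 * y * (8 * (l : ℝ) ^ 3 * L ^ 6) ≤ 4 * y * y := by gcongr
      _ ≤ 0.225 * (0.225 * y) ^ 2 * 20 ^ 2 := by nlinarith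
      _ ≤ _ := by gcongr
  have hPa : P ≤ 3.5 * a * y := by
    refine le_of_mul_le_mul_right ?_ hL0
    nlinarith
  have hla : 5 * (l : ℝ) ^ 2 ≤ a * y := by
    refine le_of_mul_le_mul_right ?_ hL0
    have h1 : (l : ℝ) ^ 2 * L ≤ (l : ℝ) ^ 3 * L := by gcongr
    nlinarith
  have hbase := abs_card_sub_le hBp hAB k l (κ := 1 + 1 / L) (by positivity) fun q hq =>
    prod_le_mul_totient hBp hBy1 hy (by positivity) ((div_le_one hL0).2 (by linarith)) hε hq
  rw [← solCount_eq, show ∑ q ∈ B, 1 / (q : ℝ) = a from rfl,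
    show (A.card : ℝ) = P from rfl, add_sub_cancel_left] at hbase
  set V : ℕ → ℝ := fun r => l.choose r * a ^ (l - r) * wsum B r (primMoment A k) with hV
  have hV0 : 0 ≤ ∑ r ∈ Finset.Icc 1 l, V r := Finset.sum_nonneg fun r _ =>
    mul_nonneg (by positivity) (wsum_nonneg _ _ fun _ => primMoment_nonneg _ _ _)
  set E := a ^ l * P ^ k * (1 / L) with hE
  have hE0 : 0 ≤ E := by positivity
  have hbase' : |(solCount y k l : ℝ) - a ^ l * P ^ k| ≤ E + 2 * ∑ r ∈ Finset.Icc 1 l, V r := by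
    refine hbase.trans ?_
    have h1 : 1 / L ≤ 1 := (div_le_one hL0).2 (by linarith)
    have h2 : 1 / L * (a ^ l * P ^ k) = E := by rw [hE, mul_comm]
    rw [h2]
    gcongr
    linarith
  have hmom : ∀ r, wsum B r (primMoment A (4 * r)) ≤
      28 * (4 * y) ^ r * r.factorial * (2 * r).factorial * P ^ (2 * r) := fun r =>
    wsum_primMoment_le_of_largeSieve (by linarith) hAp hAy hBp
      (fun q hq => ⟨hBy1 q hq, hBy2 q hq⟩) r
  have hfirst : ∀ r, 1 ≤ r → r ≤ l → 4 * r ≤ k → V r ≤ 28 * E * (1 / 2) ^ r := by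
    intro r hr hrl hrk
    refine largeSieve_term_le hr hrl hrk ha0 hP0 hy0 (by linarith) ?_ hmainsize
    refine (wsum_mono (G := fun n => P ^ (k - 4 * r) * primMoment A (4 * r) n)
      fun q _ => primMoment_le_pow_mul A hrk _).trans ?_
    rw [wsum_const_mul]
    exact mul_le_mul_of_nonneg_left (hmom r) (by positivity)
  refine ⟨fun hlk4 => ?_, fun hkl => ?_⟩
  · have hsum : ∑ r ∈ Finset.Icc 1 l, V r ≤ 28 * E * 2 := by
      refine (Finset.sum_le_sum fun r hr => hfirst r (Finset.mem_Icc.1 hr).1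
        (Finset.mem_Icc.1 hr).2 ?_).trans ?_
      · have := (Finset.mem_Icc.1 hr).2
        omega
      · rw [← Finset.mul_sum]
        exact mul_le_mul_of_nonneg_left (sum_half_pow_le l) (by positivity)
    linarith
  · set G := (l : ℝ) ^ (k - l) * (4 * a * P) ^ l * √y ^ k with hG
    have hG0 : 0 ≤ G := by positivity
    have hw : 0 < √y := Real.sqrt_pos.2 hy0
    have hw2 : √y ^ 2 = y := Real.sq_sqrt hy0.le
    have hsecond : ∀ r, 1 ≤ r → r ≤ l → 2 * r ≤ k → k ≤ 4 * r →
        V r ≤ 20000 * G * (1 / 2) ^ (l - r) := by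
      intro r hr hrl hrk hkr
      -- This `Z` balances the two moment bounds.
      set Z := √(2.5 * P * (l : ℝ) ^ 2 / a) with hZ
      have hZ0 : 0 < Z := Real.sqrt_pos.2 (by positivity)
      refine interpolated_term_le hr hrl hlk hkr ha0 hP0 hw hZ0
        (Real.sq_sqrt (by positivity)) ?_ (by rw [hw2]; exact hPa) (by rw [hw2]; exact hla)
      refine (wsum_mono (G := fun n => Z ^ (k - 2 * r) * primMoment A (2 * r) n +
        (Z ^ (4 * r - k))⁻¹ * primMoment A (4 * r) n)
        fun q _ => primMoment_le_interpolate A hZ0 hrk hkr _).trans ?_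
      rw [wsum_add, wsum_const_mul, wsum_const_mul, hw2]
      have h1 := wsum_primMoment_le_of_orthogonality (by linarith) hAp hAy hBp hBy2 hAB r
      have h2 := hmom r
      exact add_le_add (mul_le_mul_of_nonneg_left h1 (by positivity))
        (mul_le_mul_of_nonneg_left h2 (by positivity))
    have hsum : ∑ r ∈ Finset.Icc 1 l, V r ≤ 28 * E * 2 + 20000 * G * 2 := by
      refine (Finset.sum_le_sum (g := fun r => 28 * E * (1 / 2) ^ r +
        20000 * G * (1 / 2) ^ (l - r)) fun r hr => ?_).trans ?_
      · obtain ⟨hr1, hrl⟩ := Finset.mem_Icc.1 hr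
        have h1 : 0 ≤ 28 * E * (1 / 2) ^ r := by positivity
        have h2 : 0 ≤ 20000 * G * (1 / 2) ^ (l - r) := by positivity
        rcases le_total (4 * r) k with h | h
        · linarith [hfirst r hr1 hrl h]
        · linarith [hsecond r hr1 hrl (by omega) h]
      · rw [Finset.sum_add_distrib, ← Finset.mul_sum, ← Finset.mul_sum]
        exact add_le_add (mul_le_mul_of_nonneg_left (sum_half_pow_le l) (by positivity))
          (mul_le_mul_of_nonneg_left (sum_half_pow_sub_le l) (by positivity))
    linarith

open Filter in
theorem eventually_primeCount_lam_bounds : ∀ᶠ y : ℝ in atTop,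
    20 ≤ Real.log y ∧ 0.225 * y ≤ primeCount y * Real.log y ∧
      primeCount y * Real.log y ≤ 0.75 * y ∧ 0.225 ≤ lam y * Real.log y := by
  have h2 : Tendsto (fun y : ℝ => y / 2) atTop atTop := tendsto_id.atTop_div_const (by norm_num)
  have h4 : Tendsto (fun y : ℝ => y / 4) atTop atTop := tendsto_id.atTop_div_const (by norm_num)
  filter_upwards [Real.tendsto_log_atTop.eventually_ge_atTop 20, eventually_gt_atTop 4,
    h2.eventually eventually_card_primesIoc_ge, h2.eventually eventually_card_primesIoc_le,
    h4.eventually eventually_card_primesIoc_ge] with y hL hy hl hu hq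
  rw [show 2 * (y / 2) = y by ring] at hl hu
  rw [show 2 * (y / 4) = y / 2 by ring] at hq
  refine ⟨hL, by rw [primeCount]; linarith, by rw [primeCount]; linarith, ?_⟩
  have hy0 : 0 < y := by linarith
  have h1 : ((primesIoc (y / 4) (y / 2)).card : ℝ) * (2 / y) ≤ lam y := by
    rw [lam, ← nsmul_eq_mul]
    refine Finset.card_nsmul_le_sum _ _ _ fun q hq => ?_
    obtain ⟨hqp, -, hq2⟩ := mem_primesIoc.1 hq
    have hq0 : (0 : ℝ) < q := by exact_mod_cast hqp.pos
    rw [div_le_div_iff₀ hy0 hq0]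
    linarith
  have h3 : Real.log (y / 2) ≤ Real.log y := Real.log_le_log (by linarith) (by linarith)
  have h5 : 0.45 * (y / 4) ≤ (primesIoc (y / 4) (y / 2)).card * Real.log y :=
    hq.trans (mul_le_mul_of_nonneg_left h3 (Nat.cast_nonneg _))
  calc (0.225 : ℝ) = 0.45 * (y / 4) * (2 / y) := by
        field_simp
        norm_num
    _ ≤ (primesIoc (y / 4) (y / 2)).card * Real.log y * (2 / y) := by gcongr
    _ = (primesIoc (y / 4) (y / 2)).card * (2 / y) * Real.log y := by ring
    _ ≤ lam y * Real.log y := by gcongr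

theorem solCount_le {y : ℝ} (hy : 0 < y) (k l : ℕ) :
    (solCount y k l : ℝ) ≤ y ^ l * (lam y ^ l * primeCount y ^ k) := by
  have h1 : solCount y k l ≤
      (primesIoc (y / 2) y).card ^ k * (primesIoc (y / 4) (y / 2)).card ^ l := by
    rw [solCount_eq]
    refine (Finset.card_filter_le _ _).trans_eq ?_
    rw [Finset.card_product, card_tuples, card_tuples]
  have h2 : ((primesIoc (y / 4) (y / 2)).card : ℝ) ≤ y * lam y := by
    have : ((primesIoc (y / 4) (y / 2)).card : ℝ) * (1 / y) ≤ lam y := by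
      rw [lam, ← nsmul_eq_mul]
      refine Finset.card_nsmul_le_sum _ _ _ fun q hq => ?_
      obtain ⟨hqp, -, hq2⟩ := mem_primesIoc.1 hq
      have hq0 : (0 : ℝ) < q := by exact_mod_cast hqp.pos
      exact one_div_le_one_div_of_le hq0 (by linarith)
    rw [mul_one_div, div_le_iff₀ hy] at this
    linarith
  calc (solCount y k l : ℝ)
      ≤ primeCount y ^ k * ((primesIoc (y / 4) (y / 2)).card : ℝ) ^ l := by
        rw [primeCount]
        exact_mod_cast h1
    _ ≤ primeCount y ^ k * (y * lam y) ^ l := by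
        have : 0 ≤ primeCount y := Nat.cast_nonneg _
        gcongr
    _ = _ := by rw [mul_pow]; ring

/-- On a bounded range of `y` the trivial bound is within a constant factor of the main term. -/
theorem abs_solCount_sub_le_of_le {y Y : ℝ} (hy : 1 ≤ y) (hlog : 0 < Real.log y) (hyY : y ≤ Y)
    {k l : ℕ} (hl : (l : ℝ) ≤ Y) :
    |(solCount y k l : ℝ) - lam y ^ l * primeCount y ^ k| ≤
      (Y ^ ⌈Y⌉₊ + 1) * Real.log Y * (lam y ^ l * primeCount y ^ k * (1 / Real.log y)) := by
  have hlam : 0 ≤ lam y := Finset.sum_nonneg fun _ _ => by positivity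
  have hP : 0 ≤ primeCount y := Nat.cast_nonneg _
  set E := lam y ^ l * primeCount y ^ k with hE
  have hE0 : 0 ≤ E := by positivity
  have hY0 : 0 ≤ Y := by linarith
  have h1 : (solCount y k l : ℝ) ≤ Y ^ ⌈Y⌉₊ * E := by
    refine (solCount_le (by linarith) k l).trans (mul_le_mul_of_nonneg_right ?_ hE0)
    calc y ^ l ≤ Y ^ l := by gcongr
      _ ≤ Y ^ ⌈Y⌉₊ := pow_le_pow_right₀ (by linarith) (Nat.cast_le.1 (hl.trans (Nat.le_ceil Y)))
  have h2 : E ≤ Real.log Y * (E * (1 / Real.log y)) := by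
    have h3 : Real.log y ≤ Real.log Y := Real.log_le_log (by linarith) hyY
    have h4 : 1 ≤ Real.log Y * (1 / Real.log y) := by
      rw [mul_one_div, one_le_div hlog]
      exact h3
    nlinarith
  have h3 : |(solCount y k l : ℝ) - E| ≤ (Y ^ ⌈Y⌉₊ + 1) * E := by
    have h4 : (0 : ℝ) ≤ solCount y k l := Nat.cast_nonneg _
    have h5 : 0 ≤ Y ^ ⌈Y⌉₊ * E := by positivity
    rw [abs_le]
    constructor <;> nlinarith
  refine h3.trans ?_
  rw [mul_assoc]
  gcongr

end SUnit

theorem proposition2p1 :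
    ∃ C : ℝ, 0 < C ∧ ∀ (y : ℝ) (k l : ℕ), 10 ≤ y → 1 ≤ l → l ≤ k →
      (k : ℝ) ≤ y ^ (1 / 3 : ℝ) / (Real.log y) ^ 2 →
      ((l : ℝ) ≤ (k : ℝ) / 4 →
        |(SUnit.solCount y k l : ℝ) - SUnit.lam y ^ l * SUnit.primeCount y ^ k|
          ≤ C * (SUnit.lam y ^ l * SUnit.primeCount y ^ k * (1 / Real.log y))) ∧
      ((k : ℝ) / 4 ≤ (l : ℝ) → (l : ℝ) ≤ (k : ℝ) / 2 →
        |(SUnit.solCount y k l : ℝ) - SUnit.lam y ^ l * SUnit.primeCount y ^ k|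
          ≤ C * (SUnit.lam y ^ l * SUnit.primeCount y ^ k * (1 / Real.log y))
            + C * ((l : ℝ) ^ (k - l) * (4 * SUnit.lam y * SUnit.primeCount y) ^ l
                * y ^ ((k : ℝ) / 2))) := by
  obtain ⟨y₀, hy₀⟩ := Filter.eventually_atTop.1 SUnit.eventually_primeCount_lam_bounds
  set Y := max y₀ 10 with hY
  have hY10 : 10 ≤ Y := le_max_right _ _
  have hlogY : 0 < Real.log Y := Real.log_pos (by linarith)
  set C := (Y ^ ⌈Y⌉₊ + 1) * Real.log Y + 80000 with hC
  have hC1 : 80000 ≤ C := le_add_of_nonneg_left (by positivity)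
  refine ⟨C, by linarith, fun y k l hy hl hlk hk => ?_⟩
  have hy0 : 0 < y := by linarith
  have hlog1 : 1 ≤ Real.log y := by
    rw [Real.le_log_iff_exp_le hy0]
    linarith [Real.exp_one_lt_d9]
  have hlog : 0 < Real.log y := by linarith
  have hE : 0 ≤ SUnit.lam y ^ l * SUnit.primeCount y ^ k * (1 / Real.log y) := by
    have : 0 ≤ SUnit.lam y := Finset.sum_nonneg fun _ _ => by positivity
    have : 0 ≤ SUnit.primeCount y := Nat.cast_nonneg _
    positivity
  have hG : 0 ≤ (l : ℝ) ^ (k - l) * (4 * SUnit.lam y * SUnit.primeCount y) ^ l *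
      y ^ ((k : ℝ) / 2) := by
    have : 0 ≤ SUnit.lam y := Finset.sum_nonneg fun _ _ => by positivity
    have : 0 ≤ SUnit.primeCount y := Nat.cast_nonneg _
    positivity
  rcases le_total y Y with hyY | hyY
  · have hly : (l : ℝ) ≤ Y := by
      have h1 : (l : ℝ) ≤ k := by exact_mod_cast hlk
      have h2 : y ^ (1 / 3 : ℝ) / Real.log y ^ 2 ≤ y ^ (1 / 3 : ℝ) :=
        div_le_self (by positivity) (one_le_pow₀ hlog1)
      have h3 : y ^ (1 / 3 : ℝ) ≤ y ^ (1 : ℝ) :=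
        Real.rpow_le_rpow_of_exponent_le (by linarith) (by norm_num)
      rw [Real.rpow_one] at h3
      linarith
    have h := SUnit.abs_solCount_sub_le_of_le (by linarith) hlog hyY (k := k) hly
    have h' : |(SUnit.solCount y k l : ℝ) - SUnit.lam y ^ l * SUnit.primeCount y ^ k| ≤
        C * (SUnit.lam y ^ l * SUnit.primeCount y ^ k * (1 / Real.log y)) :=
      h.trans (mul_le_mul_of_nonneg_right (by linarith) hE)
    exact ⟨fun _ => h', fun _ _ => h'.trans (le_add_of_nonneg_right (mul_nonneg (by linarith) hG))⟩
  · obtain ⟨hL, hPl, hPu, hlam⟩ := hy₀ y ((le_max_left _ _).trans hyY)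
    have hk3 : (k : ℝ) ^ 3 * Real.log y ^ 6 ≤ y := by
      rw [le_div_iff₀ (by positivity)] at hk
      calc (k : ℝ) ^ 3 * Real.log y ^ 6 = ((k : ℝ) * Real.log y ^ 2) ^ 3 := by ring
        _ ≤ (y ^ (1 / 3 : ℝ)) ^ 3 := by gcongr
        _ = y := by
          rw [← Real.rpow_natCast, ← Real.rpow_mul hy0.le]
          norm_num
    have hsqrt : √y ^ k = y ^ ((k : ℝ) / 2) := by
      rw [Real.sqrt_eq_rpow, ← Real.rpow_natCast, ← Real.rpow_mul hy0.le]
      congr 1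
      ring
    refine ⟨fun h4 => ?_, fun h4 h2 => ?_⟩
    · have h4' : 4 * l ≤ k := by
        have : 4 * (l : ℝ) ≤ k := by linarith
        exact_mod_cast this
      refine ((SUnit.abs_solCount_sub_le hl (by omega) hL (by linarith) hk3 hPl hPu hlam).1
        h4').trans ?_
      exact mul_le_mul_of_nonneg_right (by linarith) hE
    · have h4' : k ≤ 4 * l := by
        have : (k : ℝ) ≤ 4 * l := by linarith
        exact_mod_cast this
      have h2' : 2 * l ≤ k := by
        have : 2 * (l : ℝ) ≤ k := by linarith
        exact_mod_cast this
      have h := (SUnit.abs_solCount_sub_le hl h2' hL (by linarith) hk3 hPl hPu hlam).2 h4'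
      rw [hsqrt] at h
      refine h.trans (add_le_add ?_ ?_)
      · exact mul_le_mul_of_nonneg_right (by linarith) hE
      · exact mul_le_mul_of_nonneg_right (by linarith) hG
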